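/- Let $n\ge 0$, let $S^n\subset\mathbb{R}^{n+1}$ be the unit sphere with its round Riemannian metric $g$, let $\mathcal N\subset S^n$ be a complete (embedded) $C^2$ submanifold without boundary, and write $\rho(x)=d(x,\mathcal N)$ for the Riemannian distance from $x$ to $\mathcal N$ with respect to $g$. The condition metric on $S^n\setminus\mathcal N$ is $g_\kappa=\rho^{-2}g$; the $g_\kappa$-length of a Lipschitz curve $c:[a,b]\to S^n\setminus\mathcal N$ is $L_\kappa(c)=\int_a^b\|\dot c(t)\|\,\rho(c(t))^{-1}\,dt$. A Lipschitz curve $\gamma:[a,b]\to S^n\setminus\mathcal N$ parametrized by $g_\kappa$-arc length is a minimizing geodesic of $g_\kappa$ if $L_\kappa(\gamma)\le L_\kappa(c)$ for every Lipschitz curve $c:[a,b]\to S^n\setminus\mathcal N$ with $c(a)=\gamma(a)$ and $c(b)=\gamma(b)$; a curve defined on an interval is a geodesic of $g_\kappa$ if it is locally a minimizing geodesic. Let $\mathcal U\subseteq S^n\setminus\mathcal N$ be the largest open set such that $\rho$ is smooth (of class $C^2$) on $\mathcal U$ and every $x\in\mathcal U$ has a unique closest point in $\mathcal N$. Then the smooth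 self-convexity property holds: for every interval $I\subseteq\mathbb R$ and every geodesic $\gamma:I\to S^n\setminus\mathcal N$ of $g_\kappa$ contained in $\mathcal U$, the function $$t\mapsto \log\frac{1}{d(\gamma(t),\mathcal N)}$$ is convex on $I$. -/

import Mathlib

open Set
open scoped ENNReal NNReal Manifold ContDiff

namespace ConditionMetric

/-- The unit sphere `S^n` of `ℝ^(n+1)`, with its standard smooth structure. -/
abbrev Sph (n : ℕ) : Type := Metric.sphere (0 : EuclideanSpace ℝ (Fin (n + 1))) 1

variable {n : ℕ}

/-- The speed of a curve in `S^n` for the round metric, i.e. the metric induced by the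
inner product of `ℝ^(n+1)`. -/
noncomputable def speed (c : ℝ → Sph n) (t : ℝ) : ℝ≥0∞ :=
  ‖deriv (fun s => (c s : EuclideanSpace ℝ (Fin (n + 1)))) t‖ₑ

/-- The arc length of `c` restricted to `[a, b]` for the metric `w ^ 2 • g`, with `g` the round
metric. -/
noncomputable def arcLength (w : Sph n → ℝ≥0∞) (c : ℝ → Sph n) (a b : ℝ) : ℝ≥0∞ :=
  ∫⁻ t in Icc a b, w (c t) * speed c t

/-- `c` restricted to `[a, b]` is a Lipschitz curve with values in `A`. -/
def IsLipschitzCurveIn (A : Set (Sph n)) (c : ℝ → Sph n) (a b : ℝ) : Prop :=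
  (∃ K : ℝ≥0, LipschitzOnWith K c (Icc a b)) ∧ MapsTo c (Icc a b) A

/-- The infimum of the round lengths of the Lipschitz curves that join `x` to `y` inside `A`
(`∞` if there are none). -/
noncomputable def innerDist (A : Set (Sph n)) (x y : Sph n) : ℝ≥0∞ :=
  ⨅ (c : ℝ → Sph n) (_ : IsLipschitzCurveIn A c 0 1 ∧ c 0 = x ∧ c 1 = y), arcLength 1 c 0 1

/-- The Riemannian distance of the round sphere. -/
noncomputable def sphDist (x y : Sph n) : ℝ≥0∞ := innerDist univ x y

/-- The Riemannian distance `d(x, N)` from `x` to `N`. -/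
noncomputable def distTo (N : Set (Sph n)) (x : Sph n) : ℝ≥0∞ := ⨅ y ∈ N, sphDist x y

/-- The real-valued function `d(·, N)`. -/
noncomputable def rho (N : Set (Sph n)) (x : Sph n) : ℝ := (distTo N x).toReal

/-- `N` is an (embedded) `C^2` submanifold without boundary of `S^n`: around each of its points
there is a chart of the maximal `C^2` atlas of `S^n` in which `N` is a linear subspace. -/
def IsC2Submanifold (N : Set (Sph n)) : Prop :=
  ∀ p ∈ N, ∃ φ ∈ IsManifold.maximalAtlas (𝓡 n) 2 (Sph n), p ∈ φ.source ∧
    ∃ V : Submodule ℝ (EuclideanSpace ℝ (Fin n)), ∀ x ∈ φ.source, x ∈ N ↔ φ x ∈ V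

/-- `N` is complete for its intrinsic distance. -/
def IsCompleteSubmanifold (N : Set (Sph n)) : Prop :=
  ∀ u : ℕ → Sph n, (∀ i, u i ∈ N) →
    (∀ ε : ℝ≥0∞, 0 < ε → ∃ k, ∀ i ≥ k, ∀ j ≥ k, innerDist N (u i) (u j) < ε) →
    ∃ y ∈ N, Filter.Tendsto (fun i => innerDist N (u i) y) Filter.atTop (nhds 0)

/-- The largest open subset of `S^n \ N` on which `d(·, N)` is smooth (of class `C^2`) and every
point has a unique closest point in `N`. -/
def smoothLocus (N : Set (Sph n)) : Set (Sph n) :=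
  ⋃₀ {W | IsOpen W ∧ W ⊆ Nᶜ ∧ ContMDiffOn (𝓡 n) 𝓘(ℝ, ℝ) 2 (rho N) W ∧
    ∀ x ∈ W, ∃! y, y ∈ N ∧ sphDist x y = distTo N x}

/-- The arc length of `c` restricted to `[a, b]` for the condition metric `d(·, N)⁻² g`. -/
noncomputable def condLength (N : Set (Sph n)) (c : ℝ → Sph n) (a b : ℝ) : ℝ≥0∞ :=
  arcLength (fun x => (distTo N x)⁻¹) c a b

/-- `γ` restricted to `[a, b]` is a minimizing geodesic of the condition metric: a Lipschitz curve
in `S^n \ N`, parametrized by arc length, which is no longer than any Lipschitz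
curve in `S^n \ N` with the same endpoints. -/
def IsMinimizingGeodesic (N : Set (Sph n)) (γ : ℝ → Sph n) (a b : ℝ) : Prop :=
  IsLipschitzCurveIn Nᶜ γ a b ∧
  (∀ s ∈ Icc a b, ∀ t ∈ Icc a b, s ≤ t → condLength N γ s t = ENNReal.ofReal (t - s)) ∧
  ∀ c : ℝ → Sph n, IsLipschitzCurveIn Nᶜ c a b → c a = γ a → c b = γ b →
    condLength N γ a b ≤ condLength N c a b

/-- `γ` restricted to the interval `I` is a geodesic of the condition metric: it is locally
a minimizing geodesic. -/
def IsGeodesic (N : Set (Sph n)) (γ : ℝ → Sph n) (I : Set ℝ) : Prop :=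
  ∀ t ∈ I, ∃ ε > 0, ∀ a ∈ I, ∀ b ∈ I, a ≤ b → |a - t| < ε → |b - t| < ε →
    IsMinimizingGeodesic N γ a b

end ConditionMetric

/-!
The proof is a first variation argument that needs no regularity of the geodesic beyond the
Lipschitz property.

Write `φ = -log ρ` along a geodesic `γ` and let `p t` be the point of `N` closest to `γ t`. Convexity
of `φ` follows from `2 φ (m) ≤ φ (a) + φ (b)` on short intervals `[a, b]` with midpoint `m`
(`convexOn_of_eventually_midpoint`), and that inequality reads `∫ η' φ' ≤ 0` for the tent function
`η` on `[a, b]`. It is obtained by moving each `γ t` away from `N` at the rate `η t * ρ`, that is, by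
varying `γ` along `η ∇(ρ ^ 2 / 2)`, since
* `⟪γ', ∇(ρ ^ 2 / 2)⟫ / ρ ^ 2 = -φ'`, so the derivative of `η` contributes `-∫ η' φ'`;
* the remaining terms are nonpositive because `Hess (ρ ^ 2 / 2) ≤ g`.

Minimality of `γ` says that the sum is nonnegative. Only variations away from `N` are needed.

On the sphere this is made explicit as follows. The Riemannian distance is `arccos ⟪x, y⟫`
(`sphDist_eq`), so `z ↦ ‖z‖ cos ρ(z / ‖z‖)` is the support function of `N`. Its gradient at a point
of the smooth locus is the closest point (`fderiv_supportFun`), which therefore is a locally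
Lipschitz function (`exists_lipschitz_isClosest`). Moreover it is monotone, `⟪γ', p'⟫ ≥ 0`, directly
from the maximality of `⟪γ t, p t⟫`; together with `r cot r ≤ 1` this replaces the Hessian bound.
The varied curve is the radial projection of `γ - ε σ p` with `σ = η ρ / sin ρ`. Its length is
estimated through `2 u ≤ 1 + u ^ 2`, which is sharp to first order because `γ` has unit speed
(`ae_norm_deriv_eq_rho`), and the expansion in `ε` is uniform in `t` by compactness
(`eventually_variedEnergy_le`). The distance from the varied point to `N` can only be bounded from
above by its distance to `p t`; the lower bound that the argument needs holds up to `O(ε ^ 2)` because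
the closest point moves by `O(ε)` (`inner_sub_smul_le`).

The smooth locus avoids the points at distance `π` from `N`, where `ρ` is not differentiable
(`neg_one_lt_inner_of_isClosest`). In dimension zero the distance of distinct points is infinite and
geodesics are defined on at most one point (`IsGeodesic.not_lt_of_dim_zero`).
-/

namespace ConditionMetric

open MeasureTheory Filter Topology

variable {n : ℕ}

/-! ### The distance of the round sphere -/

theorem ofReal_sub_le_lintegral_deriv {F : ℝ → ℝ} {a b : ℝ} (hab : a ≤ b) {K : ℝ≥0}
    (hF : LipschitzOnWith K F (Icc a b)) :
    ENNReal.ofReal (F b - F a) ≤ ∫⁻ t in Icc a b, ‖deriv F t‖ₑ := by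
  rw [← uIcc_of_le hab] at hF
  have h := hF.absolutelyContinuousOnInterval.integral_deriv_eq_sub
  rw [← h, intervalIntegral.integral_of_le hab]
  calc ENNReal.ofReal (∫ x in Ioc a b, deriv F x)
      ≤ ‖∫ x in Ioc a b, deriv F x‖ₑ := by
        rw [← ofReal_norm]
        exact ENNReal.ofReal_le_ofReal (le_abs_self _)
    _ ≤ ∫⁻ x in Ioc a b, ‖deriv F x‖ₑ := enorm_integral_le_lintegral_enorm _
    _ ≤ _ := lintegral_mono_set Ioc_subset_Icc_self

section InnerProduct

variable {E : Type*} [NormedAddCommGroup E] [InnerProductSpace ℝ E]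

theorem norm_sub_inner_smul_sq {g p : E} (hg : ‖g‖ = 1) (hp : ‖p‖ = 1) :
    ‖p - inner ℝ g p • g‖ ^ 2 = 1 - inner ℝ g p ^ 2 := by
  rw [norm_sub_sq_real, norm_smul, inner_smul_right, hg, hp, Real.norm_eq_abs, mul_one, sq_abs,
    real_inner_comm]
  ring

/-- A vector tangent to the unit sphere at `g` pairs with the point `p` at angle `θ` from `g` as
with a tangent vector of length `sin θ`. -/
theorem abs_inner_le_of_inner_eq_zero {g p v : E} (hg : ‖g‖ = 1) (hp : ‖p‖ = 1)
    (hv : inner ℝ g v = 0) : |inner ℝ v p| ≤ ‖v‖ * √(1 - inner ℝ g p ^ 2) := by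
  have h1 : inner ℝ v p = inner ℝ v (p - inner ℝ g p • g) := by
    rw [inner_sub_right, inner_smul_right, real_inner_comm g v, hv]; ring
  rw [h1, ← norm_sub_inner_smul_sq hg hp, Real.sqrt_sq (norm_nonneg _)]
  exact abs_real_inner_le_norm _ _

theorem inner_deriv_eq_zero_of_norm_eq_one {g : ℝ → E} {g' : E} {t : ℝ}
    (hg : ∀ᶠ s in 𝓝 t, ‖g s‖ = 1) (h : HasDerivAt g g' t) : inner ℝ (g t) g' = 0 := by
  have h1 : HasDerivAt (fun s => ‖g s‖ ^ 2) (2 * inner ℝ (g t) g') t := h.norm_sq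
  have h2 : HasDerivAt (fun s => ‖g s‖ ^ 2) 0 t := by
    refine (hasDerivAt_const t (1 : ℝ)).congr_of_eventuallyEq ?_
    filter_upwards [hg] with s hs
    rw [hs]; norm_num
  linarith [h1.unique h2]

end InnerProduct

theorem norm_coe (x : Sph n) : ‖(x : EuclideanSpace ℝ (Fin (n + 1)))‖ = 1 := by simp

theorem abs_inner_coe_le (x y : Sph n) :
    |inner ℝ (x : EuclideanSpace ℝ (Fin (n + 1))) (y : EuclideanSpace ℝ (Fin (n + 1)))| ≤ 1 := by
  simpa [norm_coe] using abs_real_inner_le_norm (x : EuclideanSpace ℝ (Fin (n + 1))) y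

theorem IsLipschitzCurveIn.coe {A : Set (Sph n)} {c : ℝ → Sph n} {a b : ℝ}
    (hc : IsLipschitzCurveIn A c a b) :
    ∃ K : ℝ≥0, LipschitzOnWith K (fun t => (c t : EuclideanSpace ℝ (Fin (n + 1)))) (Icc a b) := by
  obtain ⟨K, hK⟩ := hc.1
  exact ⟨K, fun x hx y hy => hK hx hy⟩

/-- A function that is Lipschitz on an interval is almost everywhere differentiable there. -/
theorem ae_hasDerivAt_of_lipschitzOnWith {F : Type*} [NormedAddCommGroup F] [NormedSpace ℝ F]
    [FiniteDimensional ℝ F] {f : ℝ → F} {K : ℝ≥0} {a b : ℝ}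
    (hf : LipschitzOnWith K f (Icc a b)) :
    ∀ᵐ t ∂(volume.restrict (Icc a b)), t ∈ Ioo a b ∧ HasDerivAt f (deriv f t) t := by
  have h1 : ∀ᵐ t ∂(volume.restrict (Icc a b)), t ∈ Ioo a b := by
    rw [← Measure.restrict_congr_set Ioo_ae_eq_Icc]
    exact ae_restrict_mem measurableSet_Ioo
  have h2 := ae_restrict_of_ae (s := Icc a b)
    (hf.ae_differentiableWithinAt_of_mem (μ := volume))
  filter_upwards [h1, h2] with t ht h
  exact ⟨ht, ((h (Ioo_subset_Icc_self ht)).differentiableAt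
    (Icc_mem_nhds ht.1 ht.2)).hasDerivAt⟩

/-- The length of a curve is at least the angle between its endpoints. The angle itself need not
be differentiable along the curve; the function `arccos (l * ⟪c 0, c t⟫)` with `l < 1` is. -/
theorem arccos_inner_le_arcLength {c : ℝ → Sph n} (hc : IsLipschitzCurveIn univ c 0 1) :
    ENNReal.ofReal (Real.arccos (inner ℝ (c 0 : EuclideanSpace ℝ (Fin (n + 1))) (c 1)))
      ≤ arcLength 1 c 0 1 := by
  set x : EuclideanSpace ℝ (Fin (n + 1)) := (c 0 : EuclideanSpace ℝ (Fin (n + 1))) with hx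
  set k : ℝ → ℝ := fun t => inner ℝ x (c t : EuclideanSpace ℝ (Fin (n + 1))) with hk
  have hk1 : ∀ t, |k t| ≤ 1 := fun t => abs_inner_coe_le _ _
  obtain ⟨K, hK⟩ := hc.coe
  have hkL : LipschitzOnWith K k (Icc 0 1) := by
    refine LipschitzOnWith.of_dist_le_mul fun s hs t ht => ?_
    have := hK.dist_le_mul s hs t ht
    refine le_trans ?_ this
    rw [Real.dist_eq, dist_eq_norm]
    simp only [hk]
    rw [← inner_sub_right]
    simpa [hx, norm_coe] using abs_real_inner_le_norm x ((c s : EuclideanSpace ℝ (Fin (n + 1))) - c t)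
  have key : ∀ l ∈ Ioo (0 : ℝ) 1,
      ENNReal.ofReal (Real.arccos (l * k 1) - Real.arccos (l * k 0)) ≤ arcLength 1 c 0 1 := by
    intro l hl
    have habs : ∀ y, |y| ≤ 1 → |l * y| ≤ l := fun y hy => by
      rw [abs_mul, abs_of_pos hl.1]; nlinarith [hl.1]
    obtain ⟨M, hM⟩ := ContDiffOn.exists_lipschitzOnWith (n := 1) (f := fun y => Real.arccos (l * y))
      (s := Icc (-1 : ℝ) 1) (fun y hy => by
        have := abs_le.1 (habs y (abs_le.2 hy))
        refine ContDiffAt.contDiffWithinAt ?_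
        refine (Real.contDiffAt_arccos (by linarith [hl.2]) (by linarith [hl.2])).comp y ?_
        fun_prop) (by simp) (convex_Icc _ _) isCompact_Icc
    have hF : LipschitzOnWith (M * K) (fun t => Real.arccos (l * k t)) (Icc 0 1) :=
      hM.comp hkL fun t _ => abs_le.1 (hk1 t)
    refine (ofReal_sub_le_lintegral_deriv zero_le_one hF).trans ?_
    rw [arcLength]
    refine lintegral_mono_ae ?_
    filter_upwards [ae_hasDerivAt_of_lipschitzOnWith hK] with t ht
    simp only [Pi.one_apply, one_mul, speed]
    set v := deriv (fun s => (c s : EuclideanSpace ℝ (Fin (n + 1)))) t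
    have hkt : HasDerivAt k (inner ℝ x v) t := by
      simpa using (hasDerivAt_const t x).inner ℝ ht.2
    have h1 := abs_le.1 (habs _ (hk1 t))
    have hd := (Real.hasDerivAt_arccos (x := l * k t) (by linarith [hl.2])
      (by linarith [hl.2])).comp t (hkt.const_mul l)
    have h0 : inner ℝ (c t : EuclideanSpace ℝ (Fin (n + 1))) v = 0 :=
      inner_deriv_eq_zero_of_norm_eq_one (Eventually.of_forall fun s => norm_coe _) ht.2
    have h2 := abs_inner_le_of_inner_eq_zero (norm_coe (c t)) (norm_coe (c 0)) h0
    rw [real_inner_comm, real_inner_comm (c 0 : EuclideanSpace ℝ (Fin (n + 1)))] at h2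
    change |inner ℝ x v| ≤ ‖v‖ * √(1 - (k t) ^ 2) at h2
    have hd' : deriv (fun s => Real.arccos (l * k s)) t = _ := hd.deriv
    rw [hd', ← ofReal_norm, ← ofReal_norm]
    refine ENNReal.ofReal_le_ofReal ?_
    have hpos : 0 < 1 - (l * k t) ^ 2 := by nlinarith [hl.1, hl.2]
    rw [norm_mul, norm_neg, norm_div, norm_one, Real.norm_eq_abs, Real.norm_eq_abs,
      abs_of_pos (Real.sqrt_pos.2 hpos), abs_mul, abs_of_pos hl.1, one_div,
      inv_mul_le_iff₀ (Real.sqrt_pos.2 hpos)]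
    have h3 : √(1 - (k t) ^ 2) ≤ √(1 - (l * k t) ^ 2) := by
      apply Real.sqrt_le_sqrt
      have : l ^ 2 ≤ 1 := by nlinarith [hl.1, hl.2]
      nlinarith [sq_nonneg (k t)]
    calc l * |inner ℝ x v| ≤ 1 * (‖v‖ * √(1 - (k t) ^ 2)) :=
          mul_le_mul hl.2.le h2 (abs_nonneg _) zero_le_one
      _ ≤ √(1 - (l * k t) ^ 2) * ‖v‖ := by
          rw [one_mul, mul_comm]; gcongr
  have hk0 : k 0 = 1 := by simp [hk, hx]
  have hlim : Tendsto (fun l : ℝ => ENNReal.ofReal (Real.arccos (l * k 1) - Real.arccos (l * k 0)))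
      (𝓝[<] 1) (𝓝 (ENNReal.ofReal (Real.arccos (k 1)))) := by
    refine ENNReal.tendsto_ofReal ?_
    have : Continuous fun l : ℝ => Real.arccos (l * k 1) - Real.arccos (l * k 0) := by fun_prop
    have h := (this.tendsto 1).mono_left (nhdsWithin_le_nhds (s := Iio 1))
    simpa [hk0] using h
  refine le_of_tendsto hlim ?_
  filter_upwards [Ioo_mem_nhdsLT (zero_lt_one' ℝ)] with l hl using key l hl

/-- In dimension at least two every unit vector has a unit vector orthogonal to it. -/
theorem exists_unit_orthogonal (hn : n ≠ 0) (x : EuclideanSpace ℝ (Fin (n + 1))) :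
    ∃ e : EuclideanSpace ℝ (Fin (n + 1)), ‖e‖ = 1 ∧ inner ℝ x e = 0 := by
  have h : (ℝ ∙ x)ᗮ ≠ ⊥ := by
    intro h
    have h1 := Submodule.finrank_add_finrank_orthogonal (ℝ ∙ x)
    have h2 := finrank_span_le_card (R := ℝ) ({x} : Set (EuclideanSpace ℝ (Fin (n + 1))))
    simp only [Set.toFinset_singleton, Finset.card_singleton] at h2
    rw [h] at h1
    simp at h1
    omega
  obtain ⟨v, hv, hv0⟩ := Submodule.exists_mem_ne_zero_of_ne_bot h
  refine ⟨‖v‖⁻¹ • v, by simp [norm_smul, hv0], ?_⟩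
  rw [inner_smul_right, Submodule.mem_orthogonal_singleton_iff_inner_right.1 hv, mul_zero]

theorem norm_cos_smul_add_sin_smul {E : Type*} [NormedAddCommGroup E] [InnerProductSpace ℝ E]
    {x e : E} (hx : ‖x‖ = 1) (he : ‖e‖ = 1) (h : inner ℝ x e = 0) (θ : ℝ) :
    ‖Real.cos θ • x + Real.sin θ • e‖ = 1 := by
  have h1 : ‖Real.cos θ • x + Real.sin θ • e‖ ^ 2 = 1 := by
    rw [norm_add_sq_real, norm_smul, norm_smul, inner_smul_left, inner_smul_right, h, hx, he]
    simp
  nlinarith [norm_nonneg (Real.cos θ • x + Real.sin θ • e)]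

/-- The great circle through `x` with initial velocity `e`. -/
noncomputable def greatCircle (x : Sph n) {e : EuclideanSpace ℝ (Fin (n + 1))} (he : ‖e‖ = 1)
    (h : inner ℝ (x : EuclideanSpace ℝ (Fin (n + 1))) e = 0) (θ : ℝ) : Sph n :=
  ⟨Real.cos θ • (x : EuclideanSpace ℝ (Fin (n + 1))) + Real.sin θ • e, by
    simpa using norm_cos_smul_add_sin_smul (norm_coe x) he h θ⟩

theorem exists_greatCircle_arccos_eq (hn : n ≠ 0) (x y : Sph n) :
    ∃ (e : EuclideanSpace ℝ (Fin (n + 1))) (he : ‖e‖ = 1)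
      (h : inner ℝ (x : EuclideanSpace ℝ (Fin (n + 1))) e = 0),
      greatCircle x he h
        (Real.arccos (inner ℝ (x : EuclideanSpace ℝ (Fin (n + 1))) y)) = y := by
  set k := inner ℝ (x : EuclideanSpace ℝ (Fin (n + 1))) (y : EuclideanSpace ℝ (Fin (n + 1))) with hk
  have hk1 := abs_le.1 (abs_inner_coe_le x y)
  have hcos : Real.cos (Real.arccos k) = k := Real.cos_arccos hk1.1 hk1.2
  have hsin : Real.sin (Real.arccos k) = √(1 - k ^ 2) := Real.sin_arccos k
  have hnorm := norm_sub_inner_smul_sq (norm_coe x) (norm_coe y)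
  rw [← hk] at hnorm
  have hnorm' : ‖(y : EuclideanSpace ℝ (Fin (n + 1))) - k • (x : EuclideanSpace ℝ (Fin (n + 1)))‖
      = √(1 - k ^ 2) := by rw [← hnorm, Real.sqrt_sq (norm_nonneg _)]
  by_cases h0 : √(1 - k ^ 2) = 0
  · obtain ⟨e, he, hxe⟩ := exists_unit_orthogonal hn (x : EuclideanSpace ℝ (Fin (n + 1)))
    refine ⟨e, he, hxe, Subtype.ext ?_⟩
    rw [h0, norm_eq_zero, sub_eq_zero] at hnorm'
    simp only [greatCircle, hcos, hsin, h0, hnorm', zero_smul, add_zero]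
  · refine ⟨(√(1 - k ^ 2))⁻¹ • ((y : EuclideanSpace ℝ (Fin (n + 1))) - k • x), ?_, ?_, ?_⟩
    · rw [norm_smul, hnorm', norm_inv, Real.norm_of_nonneg (Real.sqrt_nonneg _),
        inv_mul_cancel₀ h0]
    · rw [inner_smul_right, inner_sub_right, inner_smul_right, real_inner_self_eq_norm_sq,
        norm_coe, ← hk]
      ring
    · refine Subtype.ext ?_
      simp only [greatCircle, hcos, hsin]
      rw [smul_inv_smul₀ h0]
      abel

theorem sphDist_eq (hn : n ≠ 0) (x y : Sph n) :
    sphDist x y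
      = ENNReal.ofReal (Real.arccos (inner ℝ (x : EuclideanSpace ℝ (Fin (n + 1))) y)) := by
  apply le_antisymm
  · obtain ⟨e, he, h, hy⟩ := exists_greatCircle_arccos_eq hn x y
    set α := Real.arccos (inner ℝ (x : EuclideanSpace ℝ (Fin (n + 1))) y) with hα
    have hα0 : 0 ≤ α := Real.arccos_nonneg _
    have hder : ∀ t : ℝ, HasDerivAt
        (fun s : ℝ => (greatCircle x he h (α * s) : EuclideanSpace ℝ (Fin (n + 1))))
        (α • (Real.cos (α * t) • e + Real.sin (α * t) • (-(x : EuclideanSpace ℝ (Fin (n + 1)))))) t := by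
      intro t
      have h1 : HasDerivAt (fun s : ℝ => α * s) α t := by
        simpa using (hasDerivAt_id t).const_mul α
      have h2 := (h1.cos.smul_const (x : EuclideanSpace ℝ (Fin (n + 1)))).add
        (h1.sin.smul_const e)
      refine h2.congr_deriv ?_
      module
    have hnorm : ∀ t : ℝ, ‖α • (Real.cos (α * t) • e
        + Real.sin (α * t) • (-(x : EuclideanSpace ℝ (Fin (n + 1)))))‖ = α := by
      intro t
      rw [norm_smul, norm_cos_smul_add_sin_smul he (by simp)
        (by rw [inner_neg_right, real_inner_comm, h, neg_zero]), mul_one,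
        Real.norm_of_nonneg hα0]
    have hlip : LipschitzWith α.toNNReal fun s : ℝ => greatCircle x he h (α * s) := by
      have : LipschitzWith α.toNNReal
          (fun s : ℝ => (greatCircle x he h (α * s) : EuclideanSpace ℝ (Fin (n + 1)))) := by
        refine lipschitzWith_of_nnnorm_deriv_le (fun t => (hder t).differentiableAt) fun t => ?_
        rw [(hder t).deriv, ← NNReal.coe_le_coe, coe_nnnorm, hnorm, Real.coe_toNNReal _ hα0]
      exact fun s t => this s t
    have hc : IsLipschitzCurveIn univ (fun s : ℝ => greatCircle x he h (α * s)) 0 1 ∧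
        greatCircle x he h (α * 0) = x ∧ greatCircle x he h (α * 1) = y :=
      ⟨⟨⟨_, hlip.lipschitzOnWith⟩, mapsTo_univ _ _⟩,
        Subtype.ext (by simp [greatCircle]), by rwa [mul_one]⟩
    refine (iInf₂_le (fun s : ℝ => greatCircle x he h (α * s)) hc).trans ?_
    simp only [arcLength, speed, Pi.one_apply, one_mul, (hder _).deriv, ← ofReal_norm, hnorm]
    simp
  · refine le_iInf₂ fun c hc => ?_
    rw [← hc.2.1, ← hc.2.2]
    exact arccos_inner_le_arcLength hc.1

/-! ### Closest points on the smooth locus -/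

/-- `y` is a point of `N` closest to `x`: on the sphere this means that `y` maximizes `⟪x, ·⟫`
over `N`. -/
def IsClosest (N : Set (Sph n)) (x y : Sph n) : Prop :=
  y ∈ N ∧ ∀ w ∈ N, inner ℝ (x : EuclideanSpace ℝ (Fin (n + 1))) w
    ≤ inner ℝ (x : EuclideanSpace ℝ (Fin (n + 1))) y

theorem IsClosest.distTo_eq (hn : n ≠ 0) {N : Set (Sph n)} {x y : Sph n} (h : IsClosest N x y) :
    distTo N x
      = ENNReal.ofReal (Real.arccos (inner ℝ (x : EuclideanSpace ℝ (Fin (n + 1))) y)) := by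
  apply le_antisymm
  · exact (iInf₂_le y h.1).trans_eq (sphDist_eq hn x y)
  · refine le_iInf₂ fun w hw => ?_
    rw [sphDist_eq hn]
    exact ENNReal.ofReal_le_ofReal (Real.arccos_le_arccos (h.2 w hw))

theorem IsClosest.rho_eq (hn : n ≠ 0) {N : Set (Sph n)} {x y : Sph n} (h : IsClosest N x y) :
    rho N x = Real.arccos (inner ℝ (x : EuclideanSpace ℝ (Fin (n + 1))) y) := by
  rw [rho, h.distTo_eq hn, ENNReal.toReal_ofReal (Real.arccos_nonneg _)]

theorem IsClosest.cos_rho_eq (hn : n ≠ 0) {N : Set (Sph n)} {x y : Sph n} (h : IsClosest N x y) :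
    Real.cos (rho N x) = inner ℝ (x : EuclideanSpace ℝ (Fin (n + 1))) y := by
  have := abs_le.1 (abs_inner_coe_le x y)
  rw [h.rho_eq hn, Real.cos_arccos this.1 this.2]

theorem isOpen_smoothLocus (N : Set (Sph n)) : IsOpen (smoothLocus N) :=
  isOpen_sUnion fun _ hW => hW.1

theorem smoothLocus_subset_compl (N : Set (Sph n)) : smoothLocus N ⊆ Nᶜ :=
  sUnion_subset fun _ hW => hW.2.1

theorem contMDiffAt_rho {N : Set (Sph n)} {x : Sph n} (hx : x ∈ smoothLocus N) :
    ContMDiffAt (𝓡 n) 𝓘(ℝ, ℝ) 2 (rho N) x := by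
  obtain ⟨W, hW, hxW⟩ := hx
  exact hW.2.2.1.contMDiffAt (hW.1.mem_nhds hxW)

theorem exists_isClosest (hn : n ≠ 0) {N : Set (Sph n)} {x : Sph n} (hx : x ∈ smoothLocus N) :
    ∃ y, IsClosest N x y := by
  obtain ⟨W, hW, hxW⟩ := hx
  obtain ⟨y, ⟨hyN, hy⟩, -⟩ := hW.2.2.2 x hxW
  refine ⟨y, hyN, fun w hw => ?_⟩
  have h1 : sphDist x y ≤ sphDist x w := hy.trans_le (iInf₂_le w hw)
  rw [sphDist_eq hn, sphDist_eq hn, ENNReal.ofReal_le_ofReal_iff (Real.arccos_nonneg _)] at h1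
  have h2 := abs_le.1 (abs_inner_coe_le x y)
  have h3 := abs_le.1 (abs_inner_coe_le x w)
  exact (Real.strictAntiOn_arccos.le_iff_ge ⟨h2.1, h2.2⟩ ⟨h3.1, h3.2⟩).1 h1

/-- The radial projection of `ℝ^(n+1)` onto `S^n`, with an arbitrary value at the origin. -/
noncomputable def sphProj (z : EuclideanSpace ℝ (Fin (n + 1))) : Sph n :=
  if h : z = 0 then ⟨EuclideanSpace.single 0 1, by simp⟩ else ⟨‖z‖⁻¹ • z, by simp [norm_smul, h]⟩

theorem coe_sphProj {z : EuclideanSpace ℝ (Fin (n + 1))} (hz : z ≠ 0) :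
    (sphProj z : EuclideanSpace ℝ (Fin (n + 1))) = ‖z‖⁻¹ • z := by
  rw [sphProj, dif_neg hz]

theorem norm_smul_sphProj {z : EuclideanSpace ℝ (Fin (n + 1))} (hz : z ≠ 0) :
    ‖z‖ • (sphProj z : EuclideanSpace ℝ (Fin (n + 1))) = z := by
  rw [coe_sphProj hz, smul_inv_smul₀ (norm_ne_zero_iff.2 hz)]

theorem coe_ne_zero (x : Sph n) : (x : EuclideanSpace ℝ (Fin (n + 1))) ≠ 0 := by
  rw [← norm_ne_zero_iff, norm_coe]; exact one_ne_zero

theorem sphProj_coe (x : Sph n) : sphProj (x : EuclideanSpace ℝ (Fin (n + 1))) = x := by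
  refine Subtype.ext ?_
  rw [coe_sphProj (coe_ne_zero x), norm_coe, inv_one, one_smul]

theorem contDiffAt_inv_norm_smul {z : EuclideanSpace ℝ (Fin (n + 1))} (hz : z ≠ 0) {m : ℕ∞ω} :
    ContDiffAt ℝ m (fun z : EuclideanSpace ℝ (Fin (n + 1)) => ‖z‖⁻¹ • z) z :=
  ((contDiffAt_norm ℝ hz).inv (norm_ne_zero_iff.2 hz)).smul contDiffAt_id

theorem contDiffAt_coe_sphProj {z : EuclideanSpace ℝ (Fin (n + 1))} (hz : z ≠ 0) {m : ℕ∞ω} :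
    ContDiffAt ℝ m
      (fun z : EuclideanSpace ℝ (Fin (n + 1)) => (sphProj z : EuclideanSpace ℝ (Fin (n + 1)))) z :=
  (contDiffAt_inv_norm_smul hz).congr_of_eventuallyEq <| by
    filter_upwards [isOpen_ne.mem_nhds hz] with w hw using coe_sphProj hw

theorem continuousAt_sphProj {z : EuclideanSpace ℝ (Fin (n + 1))} (hz : z ≠ 0) :
    ContinuousAt (sphProj (n := n)) z :=
  Topology.IsInducing.subtypeVal.continuousAt_iff.2 (contDiffAt_coe_sphProj hz (m := 0)).continuousAt

theorem contMDiffAt_sphProj {z : EuclideanSpace ℝ (Fin (n + 1))} (hz : z ≠ 0) {m : ℕ∞ω} :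
    ContMDiffAt 𝓘(ℝ, EuclideanSpace ℝ (Fin (n + 1))) (𝓡 n) m (sphProj (n := n)) z := by
  have := Fact.mk (@finrank_euclideanSpace_fin ℝ _ (n + 1))
  rw [contMDiffAt_iff_target]
  refine ⟨continuousAt_sphProj hz, ?_⟩
  set v : Sph n := sphProj z with hv
  let U : _ ≃ₗᵢ[ℝ] _ :=
    (OrthonormalBasis.fromOrthogonalSpanSingleton (𝕜 := ℝ)
        n (ne_zero_of_mem_unit_sphere (-v))).repr
  have hv1 : (v : EuclideanSpace ℝ (Fin (n + 1))) ∈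
      {x : EuclideanSpace ℝ (Fin (n + 1)) | innerSL ℝ (-v : EuclideanSpace ℝ (Fin (n + 1))) x ≠ 1} := by
    simp only [mem_ofPred_eq, innerSL_apply_apply, inner_neg_left, real_inner_self_eq_norm_sq,
      norm_coe]
    norm_num
  have hopen : IsOpen
      {x : EuclideanSpace ℝ (Fin (n + 1)) | innerSL ℝ (-v : EuclideanSpace ℝ (Fin (n + 1))) x ≠ 1} :=
    isOpen_ne_fun (by fun_prop) continuous_const
  have h1 : ContDiffAt ℝ m (stereoToFun (-v : EuclideanSpace ℝ (Fin (n + 1))))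
      (sphProj z : EuclideanSpace ℝ (Fin (n + 1))) :=
    contDiffOn_stereoToFun.contDiffAt (hopen.mem_nhds hv1)
  have h2 := (U.contDiff (n := m)).contDiffAt.comp z (h1.comp z (contDiffAt_coe_sphProj hz))
  exact h2.contMDiffAt

/-- The function `ρ`, extended to be constant along rays, is of class `C^2`. -/
theorem contDiffAt_rho_sphProj {N : Set (Sph n)} {x : Sph n} (hx : x ∈ smoothLocus N) :
    ContDiffAt ℝ 2 (fun z => rho N (sphProj z)) (x : EuclideanSpace ℝ (Fin (n + 1))) := by
  have h : ContMDiffAt (𝓡 n) 𝓘(ℝ, ℝ) 2 (rho N)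
      (sphProj (x : EuclideanSpace ℝ (Fin (n + 1)))) := by
    rw [sphProj_coe]; exact contMDiffAt_rho hx
  exact (h.comp _ (contMDiffAt_sphProj (coe_ne_zero x))).contDiffAt

/-- The one-homogeneous extension of `cos ρ`. It is the support function `z ↦ max ⟪z, y⟫` of `N`,
whose gradient at `x` is the point of `N` closest to `x`. -/
noncomputable def supportFun (N : Set (Sph n)) (z : EuclideanSpace ℝ (Fin (n + 1))) : ℝ :=
  ‖z‖ * Real.cos (rho N (sphProj z))

theorem contDiffAt_supportFun {N : Set (Sph n)} {x : Sph n} (hx : x ∈ smoothLocus N) :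
    ContDiffAt ℝ 2 (supportFun N) (x : EuclideanSpace ℝ (Fin (n + 1))) :=
  (contDiffAt_norm ℝ (coe_ne_zero x)).mul (contDiffAt_rho_sphProj hx).cos

theorem fderiv_supportFun (hn : n ≠ 0) {N : Set (Sph n)} {x y : Sph n} (hx : x ∈ smoothLocus N)
    (hy : IsClosest N x y) :
    fderiv ℝ (supportFun N) (x : EuclideanSpace ℝ (Fin (n + 1)))
      = innerSL ℝ (y : EuclideanSpace ℝ (Fin (n + 1))) := by
  have hd := (contDiffAt_supportFun hx).differentiableAt (by norm_num)
  have hmin : IsLocalMin (fun z => supportFun N z - innerSL ℝ (y : EuclideanSpace ℝ (Fin (n + 1))) z)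
      (x : EuclideanSpace ℝ (Fin (n + 1))) := by
    have hU : ∀ᶠ z in 𝓝 (x : EuclideanSpace ℝ (Fin (n + 1))), sphProj z ∈ smoothLocus N := by
      refine (continuousAt_sphProj (coe_ne_zero x)).eventually_mem ?_
      rw [sphProj_coe]
      exact (isOpen_smoothLocus N).mem_nhds hx
    filter_upwards [hU, isOpen_ne.mem_nhds (coe_ne_zero x)] with z hz hz0
    have hx0 : supportFun N x - innerSL ℝ (y : EuclideanSpace ℝ (Fin (n + 1))) x = 0 := by
      rw [supportFun, sphProj_coe, hy.cos_rho_eq hn, norm_coe, innerSL_apply_apply, one_mul,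
        real_inner_comm, sub_self]
    obtain ⟨q, hq⟩ := exists_isClosest hn hz
    rw [hx0, supportFun, hq.cos_rho_eq hn, sub_nonneg, innerSL_apply_apply, real_inner_comm]
    calc inner ℝ z (y : EuclideanSpace ℝ (Fin (n + 1)))
        = ‖z‖ * inner ℝ (sphProj z : EuclideanSpace ℝ (Fin (n + 1))) y := by
          rw [← real_inner_smul_left, norm_smul_sphProj hz0]
      _ ≤ _ := by gcongr; exact hq.2 y hy.1
  have h := hmin.fderiv_eq_zero
  rw [fderiv_fun_sub hd (ContinuousLinearMap.differentiableAt _), ContinuousLinearMap.fderiv,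
    sub_eq_zero] at h
  exact h

/-- On the smooth locus the closest point depends on the point in a locally Lipschitz way, since
it is the gradient of a function of class `C^2`. -/
theorem exists_lipschitz_isClosest (hn : n ≠ 0) {N : Set (Sph n)} {x : Sph n}
    (hx : x ∈ smoothLocus N) :
    ∃ δ > 0, ∃ L : ℝ≥0, Metric.ball x δ ⊆ smoothLocus N ∧
      ∀ w ∈ Metric.ball x δ, ∀ w' ∈ Metric.ball x δ, ∀ y y', IsClosest N w y → IsClosest N w' y' →
        dist y y' ≤ L * dist w w' := by
  have h1 : ContDiffAt ℝ 1 (fderiv ℝ (supportFun N)) (x : EuclideanSpace ℝ (Fin (n + 1))) :=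
    (contDiffAt_supportFun hx).fderiv_right (by norm_num)
  obtain ⟨L, t, ht, hL⟩ := h1.exists_lipschitzOnWith
  have ht' : (Subtype.val ⁻¹' t ∩ smoothLocus N : Set (Sph n)) ∈ 𝓝 x :=
    inter_mem (continuous_subtype_val.continuousAt.preimage_mem_nhds ht)
      ((isOpen_smoothLocus N).mem_nhds hx)
  obtain ⟨δ, hδ, hball⟩ := Metric.mem_nhds_iff.1 ht'
  refine ⟨δ, hδ, L, fun w hw => (hball hw).2, fun w hw w' hw' y y' hy hy' => ?_⟩
  have h := hL.dist_le_mul _ (hball hw).1 _ (hball hw').1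
  rw [fderiv_supportFun hn (hball hw).2 hy, fderiv_supportFun hn (hball hw').2 hy',
    dist_eq_norm, ← map_sub, innerSL_apply_norm, ← dist_eq_norm] at h
  exact h

/-- At distance `π` from `N` the set `N` would be the antipode of `x`, and the distance to it is
not differentiable at `x`. -/
theorem neg_one_lt_inner_of_isClosest (hn : n ≠ 0) {N : Set (Sph n)} {x y : Sph n}
    (hx : x ∈ smoothLocus N) (hy : IsClosest N x y) :
    -1 < inner ℝ (x : EuclideanSpace ℝ (Fin (n + 1))) y := by
  refine lt_of_le_of_ne (abs_le.1 (abs_inner_coe_le x y)).1 fun h => ?_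
  have hanti : ∀ w ∈ N, w = -x := by
    intro w hw
    have h1 : inner ℝ (x : EuclideanSpace ℝ (Fin (n + 1))) (w : EuclideanSpace ℝ (Fin (n + 1))) = -1 :=
      le_antisymm (h ▸ hy.2 w hw) (abs_le.1 (abs_inner_coe_le x w)).1
    have h2 := (inner_eq_one_iff_of_norm_eq_one (𝕜 := ℝ)
      (x := (x : EuclideanSpace ℝ (Fin (n + 1)))) (y := -(w : EuclideanSpace ℝ (Fin (n + 1))))
      (norm_coe x) (by rw [norm_neg, norm_coe])).1 (by rw [inner_neg_right, h1, neg_neg])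
    refine Subtype.ext ?_
    rw [coe_neg_sphere, h2, neg_neg]
  have hyx := hanti y hy.1
  obtain ⟨e, he, hxe⟩ := exists_unit_orthogonal hn (x : EuclideanSpace ℝ (Fin (n + 1)))
  have hrho : ∀ θ : ℝ, |θ| ≤ Real.pi → rho N (greatCircle x he hxe θ) = Real.pi - |θ| := by
    intro θ hθ
    have hcl : IsClosest N (greatCircle x he hxe θ) y :=
      ⟨hy.1, fun w hw => by rw [hanti w hw, hyx]⟩
    rw [hcl.rho_eq hn, hyx, coe_neg_sphere, inner_neg_right, Real.arccos_neg]
    simp only [greatCircle]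
    rw [inner_add_left, real_inner_smul_left, real_inner_smul_left, real_inner_self_eq_norm_sq,
      norm_coe, one_pow, real_inner_comm, hxe, mul_one, mul_zero, add_zero]
    rw [← Real.cos_abs, Real.arccos_cos (abs_nonneg _) hθ]
  have hd : DifferentiableAt ℝ (fun θ : ℝ => rho N (sphProj
      (Real.cos θ • (x : EuclideanSpace ℝ (Fin (n + 1))) + Real.sin θ • e))) 0 := by
    have h1 := (contDiffAt_rho_sphProj hx).differentiableAt (by norm_num)
    have h2 : DifferentiableAt ℝ (fun θ : ℝ =>
      Real.cos θ • (x : EuclideanSpace ℝ (Fin (n + 1))) + Real.sin θ • e) 0 := by fun_prop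
    refine DifferentiableAt.comp (0 : ℝ) (g := fun z => rho N (sphProj z)) ?_ h2
    simpa using h1
  refine not_differentiableAt_abs_zero (((differentiableAt_const Real.pi).sub hd).congr_of_eventuallyEq ?_)
  have hsmall : ∀ᶠ θ : ℝ in 𝓝 0, |θ| < Real.pi :=
    continuous_abs.continuousAt.eventually_lt continuousAt_const (by simpa using Real.pi_pos)
  filter_upwards [hsmall] with θ hθ
  have := hrho θ hθ.le
  rw [← sphProj_coe (greatCircle x he hxe θ)] at this
  change |θ| = Real.pi - rho N (sphProj (greatCircle x he hxe θ : EuclideanSpace ℝ (Fin (n + 1))))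
  rw [this]; ring

theorem inner_lt_one_of_isClosest {N : Set (Sph n)} {x y : Sph n}
    (hx : x ∈ smoothLocus N) (hy : IsClosest N x y) :
    inner ℝ (x : EuclideanSpace ℝ (Fin (n + 1))) y < 1 := by
  refine lt_of_le_of_ne (abs_le.1 (abs_inner_coe_le x y)).2 fun h => ?_
  rw [inner_eq_one_iff_of_norm_eq_one (norm_coe x) (norm_coe y)] at h
  exact smoothLocus_subset_compl N hx (Subtype.ext h ▸ hy.1)

/-! ### Calculus along Lipschitz curves -/

/-- First-order Taylor expansion in one variable, uniformly for a parameter in a compact set. -/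
theorem eventually_forall_le_add_of_isCompact {P : Type*} [NormedAddCommGroup P] [NormedSpace ℝ P]
    {Ψ : ℝ × P → ℝ} {D : P → ℝ} {C : Set P} (hC : IsCompact C)
    (hΨ : ∀ x ∈ C, ContDiffAt ℝ 1 Ψ (0, x))
    (hD : ∀ x ∈ C, HasDerivAt (fun ε => Ψ (ε, x)) (D x) 0) {κ : ℝ} (hκ : 0 < κ) :
    ∀ᶠ ε in 𝓝 (0 : ℝ), ∀ x ∈ C, Ψ (ε, x) ≤ Ψ (0, x) + ε * D x + κ * |ε| := by
  suffices h : ∀ᶠ ε in 𝓝 (0 : ℝ), ∀ x ∈ C, x ∈ C → Ψ (ε, x) ≤ Ψ (0, x) + ε * D x + κ * |ε| by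
    filter_upwards [h] with ε hε x hx using hε x hx hx
  refine hC.eventually_forall_of_forall_eventually fun x₀ hx₀ => ?_
  have hDeq : ∀ x ∈ C, D x = fderiv ℝ Ψ (0, x) (1, 0) := by
    intro x hx
    have h1 : HasDerivAt (fun ε : ℝ => (ε, x)) ((1 : ℝ), (0 : P)) 0 :=
      (hasDerivAt_id (0 : ℝ)).prodMk (hasDerivAt_const (0 : ℝ) x)
    have h2 := ((hΨ x hx).differentiableAt one_ne_zero).hasFDerivAt
    exact (hD x hx).unique (h2.comp_hasDerivAt (0 : ℝ) h1)
  have hstrict := (hΨ x₀ hx₀).hasStrictFDerivAt one_ne_zero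
  have h1 := hstrict.isLittleO.def (half_pos hκ)
  have hcont : ContinuousAt (fun q => fderiv ℝ Ψ q (1, 0)) ((0 : ℝ), x₀) :=
    (((hΨ x₀ hx₀).fderiv_right (m := 0) (by norm_num)).continuousAt).clm_apply continuousAt_const
  have hpair : Tendsto (fun q : ℝ × P => (((q.1, q.2) : ℝ × P), (((0 : ℝ), q.2) : ℝ × P)))
      (𝓝 ((0 : ℝ), x₀)) (𝓝 (((0 : ℝ), x₀), ((0 : ℝ), x₀))) :=
    Continuous.tendsto' (by fun_prop) _ _ rfl
  have hsnd : Tendsto (fun q : ℝ × P => (((0 : ℝ), q.2) : ℝ × P))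
      (𝓝 ((0 : ℝ), x₀)) (𝓝 ((0 : ℝ), x₀)) :=
    Continuous.tendsto' (by fun_prop) _ _ rfl
  have h2 := (hcont.tendsto.comp hsnd).eventually (Metric.ball_mem_nhds _ (half_pos hκ))
  filter_upwards [hpair.eventually h1, h2] with q hq1 hq2 hqC
  obtain ⟨ε, x⟩ := q
  simp only at hq1 hqC
  simp only [Function.comp, Real.dist_eq] at hq2
  rw [← hDeq x hqC, ← hDeq x₀ hx₀] at hq2
  have h3 : ((ε, x) : ℝ × P) - (0, x) = ε • ((1 : ℝ), (0 : P)) := by simp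
  rw [h3, map_smul, ← hDeq x₀ hx₀, norm_smul, smul_eq_mul, Real.norm_eq_abs, Real.norm_eq_abs] at hq1
  have h4 : ‖((1 : ℝ), (0 : P))‖ = 1 := by simp [Prod.norm_def]
  rw [h4, mul_one] at hq1
  have h5 := (abs_le.1 hq1).2
  have h6 : ε * (D x₀ - D x) ≤ κ / 2 * |ε| := by
    calc ε * (D x₀ - D x) ≤ |ε * (D x₀ - D x)| := le_abs_self _
      _ = |D x - D x₀| * |ε| := by rw [abs_mul, abs_sub_comm, mul_comm]
      _ ≤ _ := by gcongr
  nlinarith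

theorem exists_lipschitzOnWith_comp {f u : ℝ → ℝ} {a b c d : ℝ} {K : ℝ≥0} (hab : a ≤ b)
    (hf : ContDiffOn ℝ 1 f (Ioo c d)) (hu : LipschitzOnWith K u (Icc a b))
    (hcd : MapsTo u (Icc a b) (Ioo c d)) :
    ∃ M : ℝ≥0, LipschitzOnWith M (fun t => f (u t)) (Icc a b) := by
  have hne : (Icc a b).Nonempty := nonempty_Icc.2 hab
  obtain ⟨s, hs, hmin⟩ := isCompact_Icc.exists_isMinOn hne hu.continuousOn
  obtain ⟨t, ht, hmax⟩ := isCompact_Icc.exists_isMaxOn hne hu.continuousOn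
  have hsub : Icc (u s) (u t) ⊆ Ioo c d := fun x hx =>
    ⟨(hcd hs).1.trans_le hx.1, hx.2.trans_lt (hcd ht).2⟩
  obtain ⟨M, hM⟩ := (hf.mono hsub).exists_lipschitzOnWith one_ne_zero (convex_Icc _ _) isCompact_Icc
  exact ⟨M * K, hM.comp hu fun x hx => ⟨hmin hx, hmax hx⟩⟩

section InnerProduct

variable {E : Type*} [NormedAddCommGroup E] [InnerProductSpace ℝ E]

theorem lipschitzOnWith_inner {g q : ℝ → E} {K M : ℝ≥0} {s : Set ℝ} (hg : LipschitzOnWith K g s)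
    (hq : LipschitzOnWith M q s) (hg1 : ∀ t ∈ s, ‖g t‖ = 1) (hq1 : ∀ t ∈ s, ‖q t‖ = 1) :
    LipschitzOnWith (K + M) (fun t => inner ℝ (g t) (q t)) s := by
  refine LipschitzOnWith.of_dist_le_mul fun x hx y hy => ?_
  have h : (inner ℝ (g x) (q x) : ℝ) - inner ℝ (g y) (q y)
      = inner ℝ (g x - g y) (q x) + inner ℝ (g y) (q x - q y) := by
    rw [inner_sub_left, inner_sub_right]; ring
  have h1 := abs_real_inner_le_norm (g x - g y) (q x)
  have h2 := abs_real_inner_le_norm (g y) (q x - q y)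
  have h3 := hg.dist_le_mul x hx y hy
  have h4 := hq.dist_le_mul x hx y hy
  rw [dist_eq_norm] at h3 h4
  rw [hq1 x hx, mul_one] at h1
  rw [hg1 y hy, one_mul] at h2
  rw [Real.dist_eq, h, NNReal.coe_add, add_mul]
  exact (abs_add_le _ _).trans (add_le_add (h1.trans h3) (h2.trans h4))

/-- The derivative of a monotone relation: if `⟪g s - g t, q s - q t⟫ ≥ 0` near `t`, then
`⟪g', q'⟫ ≥ 0`. -/
theorem inner_deriv_nonneg {g q : ℝ → E} {g' q' : E} {t : ℝ} (hg : HasDerivAt g g' t)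
    (hq : HasDerivAt q q' t) (h : ∀ᶠ s in 𝓝 t, 0 ≤ (inner ℝ (g s - g t) (q s - q t) : ℝ)) :
    0 ≤ (inner ℝ g' q' : ℝ) := by
  have h1 := (hasDerivAt_iff_tendsto_slope.1 hg).inner (𝕜 := ℝ) (hasDerivAt_iff_tendsto_slope.1 hq)
  refine ge_of_tendsto h1 ?_
  filter_upwards [nhdsWithin_le_nhds h] with s hs
  rw [slope_def_module, slope_def_module, real_inner_smul_left, real_inner_smul_right, ← mul_assoc]
  exact mul_nonneg (mul_self_nonneg _) hs

/-- An envelope theorem: when `q t` maximizes `⟪g t, ·⟫` among the values of `q`, only the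
variation of `g` contributes to the derivative of `⟪g, q⟫`. -/
theorem hasDerivAt_inner_of_isMax {g q : ℝ → E} {g' q' : E} {t : ℝ} (hg : HasDerivAt g g' t)
    (hq : HasDerivAt q q' t)
    (h : ∀ᶠ s in 𝓝 t, (inner ℝ (g s) (q t) : ℝ) ≤ inner ℝ (g s) (q s)) :
    HasDerivAt (fun s => (inner ℝ (g s) (q s) : ℝ)) (inner ℝ g' (q t)) t := by
  have h1 : HasDerivAt (fun s => (inner ℝ (g s) (q s) : ℝ)) _ t := hg.inner ℝ hq
  have h2 : HasDerivAt (fun s => (inner ℝ (g s) (q t) : ℝ)) _ t :=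
    hg.inner ℝ (hasDerivAt_const t (q t))
  have hmin : IsLocalMin
      ((fun s => (inner ℝ (g s) (q s) : ℝ)) - fun s => (inner ℝ (g s) (q t) : ℝ)) t := by
    filter_upwards [h] with s hs
    simpa using hs
  have h3 := hmin.hasDerivAt_eq_zero (h1.sub h2)
  rw [inner_zero_right, zero_add] at h3
  convert h1 using 1
  linarith

/-- Radial projection to the unit sphere does not increase the derivative of a curve by more than
the factor `1 / ‖z‖`, since it drops the radial part. -/
theorem norm_le_div_of_hasDerivAt_normalize {z : ℝ → E} {z' c' : E} {t : ℝ}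
    (hz : HasDerivAt z z' t) (hz0 : z t ≠ 0)
    (hc : HasDerivAt (fun s => ‖z s‖⁻¹ • z s) c' t) : ‖c'‖ ≤ ‖z'‖ / ‖z t‖ := by
  have hpos : 0 < ‖z t‖ := norm_pos_iff.2 hz0
  have hne : ∀ᶠ s in 𝓝 t, z s ≠ 0 := hz.continuousAt.eventually_ne hz0
  have horth : inner ℝ (‖z t‖⁻¹ • z t) c' = 0 := by
    refine inner_deriv_eq_zero_of_norm_eq_one ?_ hc
    filter_upwards [hne] with s hs
    rw [norm_smul, norm_inv, norm_norm, inv_mul_cancel₀ (norm_ne_zero_iff.2 hs)]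
  obtain ⟨ν', hν⟩ : ∃ ν', HasDerivAt (fun s => ‖z s‖) ν' t :=
    ⟨_, (hz.differentiableAt.norm ℝ hz0).hasDerivAt⟩
  have hprod := hν.smul hc
  have heq : z' = ‖z t‖ • c' + ν' • (‖z t‖⁻¹ • z t) := by
    refine hz.unique (hprod.congr_of_eventuallyEq ?_)
    filter_upwards [hne] with s hs
    simp [smul_inv_smul₀ (norm_ne_zero_iff.2 hs)]
  rw [le_div_iff₀ hpos]
  refine abs_le_of_sq_le_sq' ?_ (norm_nonneg _) |>.2
  rw [heq, norm_add_sq_real, real_inner_smul_left, real_inner_smul_right, real_inner_comm, horth,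
    norm_smul, norm_norm]
  nlinarith [sq_nonneg ‖ν' • (‖z t‖⁻¹ • z t)‖]

theorem norm_normalize_sub_le {z w : E} (hz : z ≠ 0) (hw : w ≠ 0) :
    ‖‖z‖⁻¹ • z - ‖w‖⁻¹ • w‖ ≤ 2 * ‖z - w‖ / ‖z‖ := by
  have hz' : 0 < ‖z‖ := norm_pos_iff.2 hz
  have hw' : 0 < ‖w‖ := norm_pos_iff.2 hw
  have h : ‖z‖⁻¹ • z - ‖w‖⁻¹ • w = ‖z‖⁻¹ • ((z - w) + ((‖w‖ - ‖z‖) * ‖w‖⁻¹) • w) := by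
    rw [sub_mul, mul_inv_cancel₀ hw'.ne', sub_smul, one_smul, mul_smul, sub_add_sub_cancel,
      smul_sub, inv_smul_smul₀ hz'.ne']
  have h1 : ‖((‖w‖ - ‖z‖) * ‖w‖⁻¹) • w‖ ≤ ‖z - w‖ := by
    rw [norm_smul, norm_mul, norm_inv, norm_norm, mul_assoc, inv_mul_cancel₀ hw'.ne', mul_one,
      Real.norm_eq_abs, abs_sub_comm]
    exact abs_norm_sub_norm_le _ _
  rw [h, norm_smul, norm_inv, norm_norm, div_eq_inv_mul]
  gcongr
  linarith [norm_add_le (z - w) (((‖w‖ - ‖z‖) * ‖w‖⁻¹) • w)]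

end InnerProduct

theorem dist_sphProj_le {z w : EuclideanSpace ℝ (Fin (n + 1))} (hz : z ≠ 0) (hw : w ≠ 0) :
    dist (sphProj z) (sphProj w) ≤ 2 * ‖z - w‖ / ‖z‖ := by
  rw [Subtype.dist_eq, coe_sphProj hz, coe_sphProj hw, dist_eq_norm]
  exact norm_normalize_sub_le hz hw

theorem norm_deriv_sphProj_le {z : ℝ → EuclideanSpace ℝ (Fin (n + 1))}
    {z' : EuclideanSpace ℝ (Fin (n + 1))} {t : ℝ} (hz : HasDerivAt z z' t) (hz0 : z t ≠ 0) :
    ‖deriv (fun s => (sphProj (z s) : EuclideanSpace ℝ (Fin (n + 1)))) t‖ ≤ ‖z'‖ / ‖z t‖ := by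
  have hd : DifferentiableAt ℝ (fun s => ‖z s‖⁻¹ • z s) t :=
    ((contDiffAt_inv_norm_smul hz0 (m := 1)).differentiableAt one_ne_zero).comp t
      hz.differentiableAt
  have heq : (fun s => (sphProj (z s) : EuclideanSpace ℝ (Fin (n + 1))))
      =ᶠ[𝓝 t] fun s => ‖z s‖⁻¹ • z s := by
    filter_upwards [hz.continuousAt.eventually_ne hz0] with s hs using coe_sphProj hs
  rw [heq.deriv_eq]
  exact norm_le_div_of_hasDerivAt_normalize hz hz0 hd.hasDerivAt

/-! ### Expansion of the energy of a varied curve -/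

/-- For unit vectors `g`, `q` at angle `r` this is `‖g - (ε * σ) • q‖ ^ 2`. -/
noncomputable def variedNormSq (ε r σ : ℝ) : ℝ := 1 - 2 * ε * σ * Real.cos r + ε ^ 2 * σ ^ 2

/-- An upper bound for the cosine of the distance from `N` to the varied point, up to a
second-order error `C * ε ^ 2`. -/
noncomputable def variedCos (C ε r σ : ℝ) : ℝ :=
  (Real.cos r - ε * σ + C * ε ^ 2) / √(variedNormSq ε r σ)

/-- An upper bound for the squared speed of the varied curve in the condition metric. Here `X` is
the first-order variation of the squared speed of the curve in `ℝ^(n+1)`, and `C`, `B` bound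
second-order errors. -/
noncomputable def variedEnergy (C B ε r σ X : ℝ) : ℝ :=
  (r ^ 2 + ε * X + B * ε ^ 2) / (variedNormSq ε r σ * Real.arccos (variedCos C ε r σ) ^ 2)

theorem variedNormSq_zero (r σ : ℝ) : variedNormSq 0 r σ = 1 := by simp [variedNormSq]

theorem variedCos_zero (C r σ : ℝ) : variedCos C 0 r σ = Real.cos r := by
  simp [variedCos, variedNormSq_zero]

theorem variedEnergy_zero (C B : ℝ) {r : ℝ} (σ X : ℝ) (h0 : 0 < r) (h1 : r < Real.pi) :
    variedEnergy C B 0 r σ X = 1 := by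
  simp [variedEnergy, variedCos_zero, variedNormSq_zero, Real.arccos_cos h0.le h1.le, h0.ne']

theorem neg_one_lt_cos {r : ℝ} (h0 : 0 < r) (h1 : r < Real.pi) : -1 < Real.cos r := by
  rw [← Real.cos_pi]; exact Real.cos_lt_cos_of_nonneg_of_le_pi h0.le le_rfl h1

theorem cos_lt_one {r : ℝ} (h0 : 0 < r) (h1 : r < Real.pi) : Real.cos r < 1 := by
  rw [← Real.cos_zero]; exact Real.cos_lt_cos_of_nonneg_of_le_pi le_rfl h1.le h0

theorem contDiffAt_variedNormSq (r σ X : ℝ) : ContDiffAt ℝ 1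
    (fun q : ℝ × ℝ × ℝ × ℝ => variedNormSq q.1 q.2.1 q.2.2.1) (0, r, σ, X) := by
  unfold variedNormSq
  fun_prop

theorem contDiffAt_variedCos (C r σ X : ℝ) : ContDiffAt ℝ 1
    (fun q : ℝ × ℝ × ℝ × ℝ => variedCos C q.1 q.2.1 q.2.2.1) (0, r, σ, X) := by
  unfold variedCos
  refine ContDiffAt.div ?_ ((contDiffAt_variedNormSq r σ X).sqrt ?_) ?_
  · fun_prop
  · simp [variedNormSq_zero]
  · simp [variedNormSq_zero]

theorem contDiffAt_variedEnergy (C B : ℝ) {r : ℝ} (σ X : ℝ) (h0 : 0 < r) (h1 : r < Real.pi) :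
    ContDiffAt ℝ 1
      (fun q : ℝ × ℝ × ℝ × ℝ => variedEnergy C B q.1 q.2.1 q.2.2.1 q.2.2.2) (0, r, σ, X) := by
  unfold variedEnergy
  refine ContDiffAt.div ?_ ((contDiffAt_variedNormSq r σ X).mul (ContDiffAt.pow ?_ 2)) ?_
  · fun_prop
  · refine ContDiffAt.comp (g := Real.arccos) _ (Real.contDiffAt_arccos ?_ ?_)
      (contDiffAt_variedCos C r σ X)
    · simpa [variedCos_zero] using (neg_one_lt_cos h0 h1).ne'
    · simpa [variedCos_zero] using (cos_lt_one h0 h1).ne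
  · simp [variedNormSq_zero, variedCos_zero, Real.arccos_cos h0.le h1.le, h0.ne']

/-- The first variation of the squared speed. The term `2 * σ * cos r` comes from the radial
projection to the sphere, the term `- 2 * σ * sin r / r` from the change of the distance to `N`. -/
theorem hasDerivAt_variedEnergy (C B : ℝ) {r : ℝ} (σ X : ℝ) (h0 : 0 < r) (h1 : r < Real.pi) :
    HasDerivAt (fun ε => variedEnergy C B ε r σ X)
      (X / r ^ 2 + 2 * σ * Real.cos r - 2 * σ * Real.sin r / r) 0 := by
  have hsin : 0 < Real.sin r := Real.sin_pos_of_pos_of_lt_pi h0 h1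
  have hN : HasDerivAt (fun ε => variedNormSq ε r σ) (-(2 * σ * Real.cos r)) 0 := by
    unfold variedNormSq
    have h := ((((hasDerivAt_id (0 : ℝ)).const_mul (2 * σ * Real.cos r)).const_sub 1).add
      (((hasDerivAt_id (0 : ℝ)).pow 2).mul_const (σ ^ 2)))
    refine (h.congr_deriv (by simp)).congr_of_eventuallyEq (Eventually.of_forall fun ε => ?_)
    simp; ring
  have hS : HasDerivAt (fun ε => √(variedNormSq ε r σ)) (-(σ * Real.cos r)) 0 := by
    refine (hN.sqrt (by simp [variedNormSq_zero])).congr_deriv ?_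
    simp [variedNormSq_zero]
    ring
  have hnum : HasDerivAt (fun ε => Real.cos r - ε * σ + C * ε ^ 2) (-σ) 0 := by
    have h := ((((hasDerivAt_id (0 : ℝ)).mul_const σ).const_sub (Real.cos r)).add
      (((hasDerivAt_id (0 : ℝ)).pow 2).const_mul C))
    exact h.congr_deriv (by simp)
  have hA : HasDerivAt (fun ε => variedCos C ε r σ) (-(σ * Real.sin r ^ 2)) 0 := by
    refine (hnum.div hS (by simp [variedNormSq_zero])).congr_deriv ?_
    simp [variedNormSq_zero]
    rw [Real.sin_sq]; ring
  have hR : HasDerivAt (fun ε => Real.arccos (variedCos C ε r σ)) (σ * Real.sin r) 0 := by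
    have h := (Real.hasDerivAt_arccos (x := variedCos C 0 r σ)
      (by rw [variedCos_zero]; exact (neg_one_lt_cos h0 h1).ne')
      (by rw [variedCos_zero]; exact (cos_lt_one h0 h1).ne)).comp (0 : ℝ) hA
    refine h.congr_deriv ?_
    rw [variedCos_zero, ← Real.sin_sq, Real.sqrt_sq hsin.le]
    field_simp
  have hX : HasDerivAt (fun ε => r ^ 2 + ε * X + B * ε ^ 2) X 0 := by
    have h := ((((hasDerivAt_id (0 : ℝ)).mul_const X).const_add (r ^ 2)).add
      (((hasDerivAt_id (0 : ℝ)).pow 2).const_mul B))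
    exact h.congr_deriv (by simp)
  refine (hX.div (hN.mul (hR.pow 2)) ?_).congr_deriv ?_
  · simp [variedNormSq_zero, variedCos_zero, Real.arccos_cos h0.le h1.le, h0.ne']
  · simp [variedNormSq_zero, variedCos_zero, Real.arccos_cos h0.le h1.le]
    field_simp
    ring

theorem eventually_variedEnergy_le (C B S M : ℝ) {r₀ r₁ κ : ℝ} (h0 : 0 < r₀) (h1 : r₁ < Real.pi)
    (hκ : 0 < κ) :
    ∀ᶠ ε in 𝓝 (0 : ℝ), ∀ x ∈ Icc r₀ r₁ ×ˢ Icc 0 S ×ˢ Icc (-M) M,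
      variedCos C ε x.1 x.2.1 < 1 ∧ variedEnergy C B ε x.1 x.2.1 x.2.2 ≤
        1 + ε * (x.2.2 / x.1 ^ 2 + 2 * x.2.1 * Real.cos x.1 - 2 * x.2.1 * Real.sin x.1 / x.1)
          + κ * |ε| := by
  have hC : IsCompact (Icc r₀ r₁ ×ˢ Icc 0 S ×ˢ Icc (-M) M) :=
    isCompact_Icc.prod (isCompact_Icc.prod isCompact_Icc)
  have hr : ∀ x ∈ Icc r₀ r₁ ×ˢ Icc 0 S ×ˢ Icc (-M) M, 0 < x.1 ∧ x.1 < Real.pi := fun x hx =>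
    ⟨h0.trans_le hx.1.1, hx.1.2.trans_lt h1⟩
  have hE := eventually_forall_le_add_of_isCompact hC
    (Ψ := fun q : ℝ × ℝ × ℝ × ℝ => variedEnergy C B q.1 q.2.1 q.2.2.1 q.2.2.2)
    (D := fun x => x.2.2 / x.1 ^ 2 + 2 * x.2.1 * Real.cos x.1 - 2 * x.2.1 * Real.sin x.1 / x.1)
    (fun x hx => contDiffAt_variedEnergy C B _ _ (hr x hx).1 (hr x hx).2)
    (fun x hx => hasDerivAt_variedEnergy C B x.2.1 x.2.2 (hr x hx).1 (hr x hx).2) hκ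
  have hA : ∀ᶠ ε in 𝓝 (0 : ℝ), ∀ x ∈ Icc r₀ r₁ ×ˢ Icc 0 S ×ˢ Icc (-M) M,
      variedCos C ε x.1 x.2.1 < 1 := by
    refine hC.eventually_forall_of_forall_eventually fun x hx => ?_
    refine (contDiffAt_variedCos C x.1 x.2.1 x.2.2).continuousAt.eventually_lt
      continuousAt_const ?_
    rw [variedCos_zero]
    exact cos_lt_one (hr x hx).1 (hr x hx).2
  filter_upwards [hE, hA] with ε hε hε' x hx
  refine ⟨hε' x hx, (hε x hx).trans_eq ?_⟩
  rw [variedEnergy_zero C B _ _ (hr x hx).1 (hr x hx).2]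

/-- The speed of the varied curve in the condition metric is bounded through its energy. Here `Z`
is the speed of the curve in `ℝ^(n+1)`, `ν` the norm of its position and `R` the distance from its
radial projection to `N`. -/
theorem inv_mul_div_le_variedEnergy {C B ε r σ X Z ν R : ℝ} (hν : 0 < ν)
    (hνsq : ν ^ 2 = variedNormSq ε r σ) (hZ : Z ^ 2 ≤ r ^ 2 + ε * X + B * ε ^ 2)
    (hR0 : 0 ≤ R) (hR1 : R ≤ Real.pi)
    (hcos : ν * Real.cos R ≤ Real.cos r - ε * σ + C * ε ^ 2) (hA : variedCos C ε r σ < 1) :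
    R⁻¹ * (Z / ν) ≤ (1 + variedEnergy C B ε r σ X) / 2 := by
  have hsqrt : √(variedNormSq ε r σ) = ν := by rw [← hνsq, Real.sqrt_sq hν.le]
  have h1 : Real.cos R ≤ variedCos C ε r σ := by
    rw [variedCos, hsqrt, le_div_iff₀ hν, mul_comm]; exact hcos
  have h2 : Real.arccos (variedCos C ε r σ) ≤ R := by
    rw [← Real.arccos_cos hR0 hR1]; exact Real.arccos_le_arccos h1
  have h3 : 0 < Real.arccos (variedCos C ε r σ) := Real.arccos_pos.2 hA
  have h4 : (R⁻¹ * (Z / ν)) ^ 2 ≤ variedEnergy C B ε r σ X := by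
    have : (R⁻¹ * (Z / ν)) ^ 2 = Z ^ 2 / (ν ^ 2 * R ^ 2) := by
      rw [mul_pow, div_pow, inv_pow, div_eq_mul_inv, div_eq_mul_inv, mul_inv]; ring
    rw [this, hνsq, variedEnergy]
    have hpos : 0 < variedNormSq ε r σ := hνsq ▸ pow_pos hν 2
    exact div_le_div₀ ((sq_nonneg Z).trans hZ) hZ (mul_pos hpos (pow_pos h3 2)) (by gcongr)
  nlinarith [sq_nonneg (R⁻¹ * (Z / ν) - 1)]

/-! ### Minimizing geodesics -/

/-- Parametrization by `g_κ`-arc length means that the round speed is `ρ` almost everywhere. -/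
theorem ae_norm_deriv_eq_rho (hn : n ≠ 0) {N : Set (Sph n)} {γ p : ℝ → Sph n} {a b : ℝ}
    {Kp : ℝ≥0} (hγ : IsMinimizingGeodesic N γ a b) (hU : MapsTo γ (Icc a b) (smoothLocus N))
    (hp : ∀ t ∈ Icc a b, IsClosest N (γ t) (p t))
    (hpL : LipschitzOnWith Kp (fun t => (p t : EuclideanSpace ℝ (Fin (n + 1)))) (Icc a b)) :
    ∀ᵐ t ∂(volume.restrict (Icc a b)),
      ‖deriv (fun s => (γ s : EuclideanSpace ℝ (Fin (n + 1)))) t‖ = rho N (γ t) := by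
  obtain ⟨K, hK⟩ := hγ.1.coe
  set f : ℝ → ℝ≥0∞ := fun t => (distTo N (γ t))⁻¹ * speed γ t with hf
  have hlen : ∀ s ∈ Icc a b, ∫⁻ t in Icc a s, f t = ENNReal.ofReal (s - a) := fun s hs =>
    hγ.2.1 a ⟨le_rfl, hs.1.trans hs.2⟩ s hs hs.1
  have hcont : ContinuousOn (fun t => Real.arccos
      (inner ℝ (γ t : EuclideanSpace ℝ (Fin (n + 1))) (p t))) (Icc a b) :=
    Real.continuous_arccos.comp_continuousOn (hK.continuousOn.inner hpL.continuousOn)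
  have hmeas : AEMeasurable f (volume.restrict (Icc a b)) := by
    have h1 : AEMeasurable (fun t => (distTo N (γ t))⁻¹) (volume.restrict (Icc a b)) := by
      refine ((hcont.aemeasurable measurableSet_Icc).ennreal_ofReal.inv).congr ?_
      filter_upwards [ae_restrict_mem measurableSet_Icc] with t ht
      simp only [Pi.inv_apply, (hp t ht).distTo_eq hn]
    exact h1.mul (measurable_deriv _).enorm.aemeasurable
  rcases lt_or_ge b a with hab | hab
  · simp [Icc_eq_empty hab.not_ge]
  have hfin : ∫⁻ t in Icc a b, f t ≠ ⊤ := by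
    rw [hlen b ⟨hab, le_rfl⟩]; exact ENNReal.ofReal_ne_top
  have hone : f =ᵐ[volume.restrict (Icc a b)] fun _ => 1 := by
    refine (withDensity_eq_iff hmeas aemeasurable_const hfin).1 ?_
    have : IsFiniteMeasure ((volume.restrict (Icc a b)).withDensity f) := isFiniteMeasure_withDensity hfin
    refine Measure.ext_of_Iic _ _ fun s => ?_
    rw [withDensity_const, one_smul, withDensity_apply _ measurableSet_Iic, Measure.restrict_apply measurableSet_Iic,
      Measure.restrict_restrict measurableSet_Iic]
    rcases lt_or_ge s a with hs | hs
    · have : Iic s ∩ Icc a b = ∅ := by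
        ext x; simp only [mem_inter_iff, mem_Iic, mem_Icc, mem_empty_iff_false, iff_false]
        intro h; linarith [h.1, h.2.1]
      simp [this]
    · have : Iic s ∩ Icc a b = Icc a (min s b) := by
        ext x; simp only [mem_inter_iff, mem_Iic, mem_Icc, le_min_iff]; tauto
      rw [this, hlen _ ⟨le_min hs hab, min_le_right _ _⟩, Real.volume_Icc]
  filter_upwards [hone, ae_restrict_mem measurableSet_Icc] with t ht htI
  have hcl := hp t htI
  have hpos : 0 < rho N (γ t) := by
    rw [hcl.rho_eq hn]
    exact Real.arccos_pos.2 (inner_lt_one_of_isClosest (hU htI) hcl)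
  rw [hf] at ht
  simp only [speed] at ht
  rw [hcl.distTo_eq hn, ← hcl.rho_eq hn, ← ENNReal.ofReal_inv_of_pos hpos, ← ofReal_norm,
    ← ENNReal.ofReal_mul (inv_nonneg.2 hpos.le), ENNReal.ofReal_eq_one, inv_mul_eq_one₀ hpos.ne'] at ht
  exact ht.symm

/-! ### First variation -/

section InnerProduct

variable {E : Type*} [NormedAddCommGroup E] [InnerProductSpace ℝ E]

theorem norm_sub_smul_sq_eq_variedNormSq {g q : E} {r : ℝ} (ε σ : ℝ) (hg : ‖g‖ = 1)
    (hq : ‖q‖ = 1) (hr : Real.cos r = inner ℝ g q) :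
    ‖g - (ε * σ) • q‖ ^ 2 = variedNormSq ε r σ := by
  rw [variedNormSq, hr, norm_sub_sq_real, real_inner_smul_right, norm_smul, hg, hq, mul_one,
    Real.norm_eq_abs, sq_abs]
  ring

theorem norm_sub_smul_add_sq_le {g' q q' : E} {r ε s' σ S S' Q : ℝ} (hε : 0 ≤ ε) (hq : ‖q‖ = 1)
    (hg' : ‖g'‖ = r) (hmono : 0 ≤ (inner ℝ g' q' : ℝ)) (hs' : |s'| ≤ S') (hσ : 0 ≤ σ)
    (hσS : σ ≤ S) (hq' : ‖q'‖ ≤ Q) :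
    ‖g' - ε • (s' • q + σ • q')‖ ^ 2
      ≤ r ^ 2 + ε * (-2 * s' * inner ℝ g' q) + (S' + S * Q) ^ 2 * ε ^ 2 := by
  have h1 : ‖s' • q + σ • q'‖ ≤ S' + S * Q := by
    refine (norm_add_le _ _).trans (add_le_add ?_ ?_)
    · rw [norm_smul, hq, mul_one]; exact hs'
    · rw [norm_smul, Real.norm_of_nonneg hσ]
      exact mul_le_mul hσS hq' (norm_nonneg _) (hσ.trans hσS)
  have h2 : ‖s' • q + σ • q'‖ ^ 2 ≤ (S' + S * Q) ^ 2 := by gcongr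
  rw [norm_sub_sq_real, real_inner_smul_right, inner_add_right, real_inner_smul_right,
    real_inner_smul_right, norm_smul, Real.norm_of_nonneg hε, hg', mul_pow]
  have h3 := mul_nonneg hε (mul_nonneg hσ hmono)
  have h4 := mul_le_mul_of_nonneg_left h2 (sq_nonneg ε)
  linarith

/-- Moving away from `q` decreases `⟪·, y⟫` at the full rate up to second order, for every unit
vector `y` that differs from `q` by `O(ε)`. -/
theorem inner_sub_smul_le {g q y : E} {c ε σ S D : ℝ} (hε1 : ε ≤ 1) (hq : ‖q‖ = 1)
    (hy : ‖y‖ = 1) (hc : inner ℝ g y ≤ c) (hqy : ‖q - y‖ ≤ D * ε) (hσ : 0 ≤ σ) (hσS : σ ≤ S) :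
    inner ℝ (g - (ε * σ) • q) y ≤ c - ε * σ + S * D ^ 2 / 2 * ε ^ 2 := by
  have h2 : inner ℝ q y = 1 - ‖q - y‖ ^ 2 / 2 := by
    rw [norm_sub_sq_real, hq, hy]; ring
  have h3 : ‖q - y‖ ^ 2 ≤ (D * ε) ^ 2 := by gcongr
  have h5 : ε * σ * (‖q - y‖ ^ 2 / 2) ≤ S * D ^ 2 / 2 * ε ^ 2 := by
    have h6 : ε * σ ≤ S := by nlinarith
    calc ε * σ * (‖q - y‖ ^ 2 / 2) ≤ S * ((D * ε) ^ 2 / 2) := by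
          have := hσ.trans hσS
          gcongr
      _ = S * D ^ 2 / 2 * ε ^ 2 := by ring
  rw [inner_sub_left, real_inner_smul_left, h2]
  linarith

theorem exists_lipschitzOnWith_sub_smul {g q : ℝ → E} {τ : ℝ → ℝ} {K M T : ℝ≥0} {a b : ℝ}
    (hg : LipschitzOnWith K g (Icc a b)) (hq : LipschitzOnWith M q (Icc a b))
    (hτ : LipschitzOnWith T τ (Icc a b)) (hq1 : ∀ t, ‖q t‖ = 1) :
    ∃ L : ℝ≥0, LipschitzOnWith L (fun t => g t - τ t • q t) (Icc a b) := by
  obtain ⟨S, hS⟩ := isCompact_Icc.exists_bound_of_continuousOn hτ.continuousOn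
  refine ⟨K + (T + S.toNNReal * M), LipschitzOnWith.of_dist_le_mul fun s hs t ht => ?_⟩
  have hS0 : 0 ≤ S := (norm_nonneg _).trans (hS t ht)
  have h1 := hg.dist_le_mul s hs t ht
  have h2 := hq.dist_le_mul s hs t ht
  have h3 := hτ.dist_le_mul s hs t ht
  rw [dist_eq_norm] at h1 h2 h3 ⊢
  have h4 : (g s - τ s • q s) - (g t - τ t • q t)
      = (g s - g t) - ((τ s - τ t) • q s + τ t • (q s - q t)) := by module
  have h5 : ‖(τ s - τ t) • q s‖ ≤ T * dist s t := by
    rw [norm_smul, hq1, mul_one]; exact h3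
  have h6 : ‖τ t • (q s - q t)‖ ≤ S * (M * dist s t) := by
    rw [norm_smul]
    exact mul_le_mul (hS t ht) h2 (norm_nonneg _) hS0
  rw [h4]
  have h7 := norm_sub_le (g s - g t) ((τ s - τ t) • q s + τ t • (q s - q t))
  have h8 := norm_add_le ((τ s - τ t) • q s) (τ t • (q s - q t))
  push_cast [Real.coe_toNNReal S hS0]
  linarith

end InnerProduct

/-- A choice of closest points along a Lipschitz curve is Lipschitz. -/
theorem lipschitzOnWith_closest {N : Set (Sph n)} {γ p : ℝ → Sph n} {A : Set (Sph n)}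
    {T : Set ℝ} {K L : ℝ≥0}
    (hL : ∀ w ∈ A, ∀ w' ∈ A, ∀ y y', IsClosest N w y → IsClosest N w' y' →
      dist y y' ≤ L * dist w w')
    (hK : LipschitzOnWith K (fun t => (γ t : EuclideanSpace ℝ (Fin (n + 1)))) T)
    (hγA : MapsTo γ T A) (hp : ∀ t ∈ T, IsClosest N (γ t) (p t)) :
    LipschitzOnWith (L * K) (fun t => (p t : EuclideanSpace ℝ (Fin (n + 1)))) T := by
  refine LipschitzOnWith.of_dist_le_mul fun s hs t ht => ?_
  have h1 := hL _ (hγA hs) _ (hγA ht) _ _ (hp s hs) (hp t ht)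
  have h2 := hK.dist_le_mul s hs t ht
  rw [Subtype.dist_eq, Subtype.dist_eq] at h1
  rw [NNReal.coe_mul, mul_assoc]
  exact h1.trans (by gcongr)

/-- The derivative of `cos ρ` along a curve is the pairing of its velocity with the closest point. -/
theorem hasDerivAt_cos_rho (hn : n ≠ 0) {N : Set (Sph n)} {γ p : ℝ → Sph n} {t : ℝ}
    {g' q' : EuclideanSpace ℝ (Fin (n + 1))}
    (hg : HasDerivAt (fun s => (γ s : EuclideanSpace ℝ (Fin (n + 1)))) g' t)
    (hq : HasDerivAt (fun s => (p s : EuclideanSpace ℝ (Fin (n + 1)))) q' t)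
    (hp : ∀ᶠ s in 𝓝 t, IsClosest N (γ s) (p s)) :
    HasDerivAt (fun s => Real.cos (rho N (γ s)))
      (inner ℝ g' (p t : EuclideanSpace ℝ (Fin (n + 1)))) t := by
  have h1 := hasDerivAt_inner_of_isMax hg hq (by
    filter_upwards [hp] with s hs using hs.2 _ hp.self_of_nhds.1)
  refine h1.congr_of_eventuallyEq ?_
  filter_upwards [hp] with s hs using hs.cos_rho_eq hn

set_option maxHeartbeats 400000 in
/-- The first variation of the length of a minimizing geodesic `γ`, for the variation that moves
`γ t` away from the closest point `p t` by pushing it in the direction `-σ t • p t` and projecting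
back to the sphere. The expression bounded by `G` is the first variation of the squared speed,
without the term `-2 * σ * ⟪γ', p'⟫`, which has a favourable sign. -/
theorem integral_nonneg_of_isMinimizingGeodesic (hn : n ≠ 0) {N : Set (Sph n)} {γ p : ℝ → Sph n}
    {a b : ℝ} (hab : a < b) (hγ : IsMinimizingGeodesic N γ a b) {x₀ : Sph n} {δ : ℝ} {L : ℝ≥0}
    (hδ : 0 < δ) (hball : Metric.ball x₀ δ ⊆ smoothLocus N)
    (hL : ∀ w ∈ Metric.ball x₀ δ, ∀ w' ∈ Metric.ball x₀ δ, ∀ y y',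
      IsClosest N w y → IsClosest N w' y' → dist y y' ≤ L * dist w w')
    (hγx : ∀ t ∈ Icc a b, γ t ∈ Metric.ball x₀ (δ / 2))
    (hp : ∀ t ∈ Icc a b, IsClosest N (γ t) (p t))
    {r₀ r₁ : ℝ} (hr₀ : 0 < r₀) (hr₁ : r₁ < Real.pi)
    (hr : ∀ t ∈ Icc a b, rho N (γ t) ∈ Icc r₀ r₁)
    {σ : ℝ → ℝ} {S' : ℝ≥0} (hσ : LipschitzOnWith S' σ (Icc a b)) (hσ0 : ∀ t ∈ Icc a b, 0 ≤ σ t)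
    (hσa : σ a = 0) (hσb : σ b = 0) {G : ℝ → ℝ} (hG : IntervalIntegrable G volume a b)
    (hFG : ∀ᵐ t ∂(volume.restrict (Icc a b)),
      -2 * deriv σ t * deriv (fun s => Real.cos (rho N (γ s))) t / rho N (γ t) ^ 2
        + 2 * σ t * Real.cos (rho N (γ t)) - 2 * σ t * Real.sin (rho N (γ t)) / rho N (γ t) ≤ G t) :
    0 ≤ ∫ t in a..b, G t := by
  set g : ℝ → EuclideanSpace ℝ (Fin (n + 1)) := fun t => (γ t : EuclideanSpace ℝ (Fin (n + 1))) with hg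
  set q : ℝ → EuclideanSpace ℝ (Fin (n + 1)) := fun t => (p t : EuclideanSpace ℝ (Fin (n + 1))) with hq
  have hg1 : ∀ t, ‖g t‖ = 1 := fun t => norm_coe _
  have hq1 : ∀ t, ‖q t‖ = 1 := fun t => norm_coe _
  obtain ⟨K, hK⟩ := hγ.1.coe
  have hγδ : ∀ t ∈ Icc a b, γ t ∈ Metric.ball x₀ δ := fun t ht =>
    Metric.ball_subset_ball (by linarith) (hγx t ht)
  have hqL : LipschitzOnWith (L * K) q (Icc a b) := lipschitzOnWith_closest hL hK hγδ hp
  have hcos : ∀ t ∈ Icc a b, Real.cos (rho N (γ t)) = inner ℝ (g t) (q t) := fun t ht =>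
    (hp t ht).cos_rho_eq hn
  obtain ⟨S, hS⟩ := isCompact_Icc.exists_bound_of_continuousOn hσ.continuousOn
  have hσS : ∀ t ∈ Icc a b, σ t ≤ S := fun t ht => (le_abs_self _).trans (hS t ht)
  have hS0 : 0 ≤ S := (hσ0 a ⟨le_rfl, hab.le⟩).trans (hσS a ⟨le_rfl, hab.le⟩)
  -- The constants of the second-order error terms.
  set C : ℝ := S * (L * (4 * S)) ^ 2 / 2 with hC
  set B : ℝ := (S' + S * (L * K : ℝ≥0)) ^ 2 with hB
  set M : ℝ := 2 * S' * (K + L * K) with hM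
  have key : ∀ κ > 0, 0 ≤ (∫ t in a..b, G t) + κ * (b - a) := by
    intro κ hκ
    have hsmall : ∀ᶠ ε in 𝓝 (0 : ℝ), ε < 1 ∧ ε * S < 1 / 2 ∧ 4 * (ε * S) < δ / 2 := by
      have h1 : ∀ᶠ ε in 𝓝 (0 : ℝ), ε < 1 := eventually_lt_nhds one_pos
      have h2 : ∀ᶠ ε in 𝓝 (0 : ℝ), ε * S < 1 / 2 :=
        (by fun_prop : Continuous fun ε : ℝ => ε * S).continuousAt.eventually_lt
          continuousAt_const (by norm_num)
      have h3 : ∀ᶠ ε in 𝓝 (0 : ℝ), 4 * (ε * S) < δ / 2 :=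
        (by fun_prop : Continuous fun ε : ℝ => 4 * (ε * S)).continuousAt.eventually_lt
          continuousAt_const (by simpa using hδ)
      exact h1.and (h2.and h3)
    obtain ⟨ε, ⟨⟨hε1, hεS, hεδ⟩, hE⟩, hε0⟩ :=
      (((hsmall.and (eventually_variedEnergy_le C B S M hr₀ hr₁ hκ)).filter_mono
        (nhdsWithin_le_nhds (s := Ioi 0))).and self_mem_nhdsWithin).exists
    -- The varied curve is `c`, the radial projection of `z`. For small `ε` it stays in the ball on
    -- which the closest point is Lipschitz.
    set z : ℝ → EuclideanSpace ℝ (Fin (n + 1)) := fun t => g t - (ε * σ t) • q t with hz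
    have hzg : ∀ t ∈ Icc a b, ‖z t - g t‖ ≤ ε * S := by
      intro t ht
      simp only [hz, sub_sub_cancel_left, norm_neg, norm_smul, hq1, mul_one, Real.norm_eq_abs]
      rw [abs_of_nonneg (mul_nonneg hε0.le (hσ0 t ht))]
      exact mul_le_mul_of_nonneg_left (hσS t ht) hε0.le
    have hzn : ∀ t ∈ Icc a b, 1 / 2 ≤ ‖z t‖ := by
      intro t ht
      have := norm_sub_norm_le (g t) (z t)
      rw [hg1, norm_sub_rev (g t) (z t)] at this
      linarith [hzg t ht]
    have hz0 : ∀ t ∈ Icc a b, z t ≠ 0 := fun t ht =>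
      norm_pos_iff.1 (by linarith [hzn t ht])
    have hproj : ∀ t ∈ Icc a b, ∀ w, w ≠ 0 → dist (sphProj (z t)) (sphProj w) ≤ 4 * ‖z t - w‖ := by
      intro t ht w hw
      refine (dist_sphProj_le (hz0 t ht) hw).trans ?_
      rw [div_le_iff₀ (norm_pos_iff.2 (hz0 t ht))]
      nlinarith [hzn t ht, norm_nonneg (z t - w)]
    set c : ℝ → Sph n := fun t => sphProj (z t) with hc
    have hcγ : ∀ t ∈ Icc a b, dist (c t) (γ t) ≤ 4 * (ε * S) := by
      intro t ht
      have h := hproj t ht (g t) (coe_ne_zero _)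
      rw [show sphProj (g t) = γ t from sphProj_coe _] at h
      exact h.trans (by linarith [hzg t ht])
    have hcball : ∀ t ∈ Icc a b, c t ∈ Metric.ball x₀ δ := by
      intro t ht
      have h1 := hcγ t ht
      have h2 := Metric.mem_ball.1 (hγx t ht)
      rw [Metric.mem_ball]
      linarith [dist_triangle (c t) (γ t) x₀]
    obtain ⟨Kz, hKz⟩ : ∃ Kz : ℝ≥0, LipschitzOnWith Kz z (Icc a b) :=
      exists_lipschitzOnWith_sub_smul hK hqL ((lipschitzWith_smul ε).comp_lipschitzOnWith hσ) hq1
    have hcLip : IsLipschitzCurveIn Nᶜ c a b := by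
      refine ⟨⟨4 * Kz, LipschitzOnWith.of_dist_le_mul fun s hs t ht => ?_⟩, fun t ht =>
        smoothLocus_subset_compl N (hball (hcball t ht))⟩
      have h1 := hproj s hs (z t) (hz0 t ht)
      have h2 := hKz.dist_le_mul s hs t ht
      rw [dist_eq_norm] at h2
      push_cast
      linarith
    have hend : ∀ t, σ t = 0 → c t = γ t := by
      intro t ht
      simp only [hc, hz, ht, mul_zero, zero_smul, sub_zero]
      exact sphProj_coe _
    have hmin := hγ.2.2 c hcLip (hend a hσa) (hend b hσb)
    rw [hγ.2.1 a ⟨le_rfl, hab.le⟩ b ⟨hab.le, le_rfl⟩ hab.le] at hmin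
    have hspeed := ae_norm_deriv_eq_rho hn hγ (fun t ht => hball (hγδ t ht)) hp hqL
    have hbound : ∀ᵐ t ∂(volume.restrict (Icc a b)),
        0 ≤ 1 + ε / 2 * (G t + κ) ∧
        (distTo N (c t))⁻¹ * speed c t ≤ ENNReal.ofReal (1 + ε / 2 * (G t + κ)) := by
      filter_upwards [hFG, hspeed, ae_hasDerivAt_of_lipschitzOnWith hK,
        ae_hasDerivAt_of_lipschitzOnWith hqL, ae_hasDerivAt_of_lipschitzOnWith hσ]
        with t hFt hst hgt hqt hσt
      have htI : t ∈ Icc a b := Ioo_subset_Icc_self hgt.1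
      have hnhds : Icc a b ∈ 𝓝 t := Icc_mem_nhds hgt.1.1 hgt.1.2
      set g' := deriv g t with hg'
      set q' := deriv q t with hq'
      set s' := deriv σ t with hs'
      set r := rho N (γ t) with hrt
      have hmono : 0 ≤ (inner ℝ g' q' : ℝ) := by
        refine inner_deriv_nonneg hgt.2 hqt.2 ?_
        filter_upwards [hnhds] with s hs
        have h1 := (hp s hs).2 _ (hp t htI).1
        have h2 := (hp t htI).2 _ (hp s hs).1
        simp only [hq]
        rw [inner_sub_left, inner_sub_right, inner_sub_right]
        linarith
      have hcosd : deriv (fun s => Real.cos (rho N (γ s))) t = inner ℝ g' (q t) :=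
        (hasDerivAt_cos_rho hn hgt.2 hqt.2 (by filter_upwards [hnhds] with s hs using hp s hs)).deriv
      have hg'K : ‖g'‖ ≤ K := norm_deriv_le_of_lipschitzOn hnhds hK
      have hq'K : ‖q'‖ ≤ (L * K : ℝ≥0) := norm_deriv_le_of_lipschitzOn hnhds hqL
      have hs'S : |s'| ≤ S' := norm_deriv_le_of_lipschitzOn hnhds hσ
      set X := -2 * s' * inner ℝ g' (q t) with hX
      have hXM : |X| ≤ M := by
        have h1 := abs_real_inner_le_norm g' (q t)
        rw [hq1, mul_one] at h1
        rw [hX, abs_mul, abs_mul, abs_neg, abs_two, hM]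
        have h2 : |inner ℝ g' (q t)| ≤ K + L * K :=
          (h1.trans hg'K).trans (le_add_of_nonneg_right (by positivity))
        gcongr
      have hzd : HasDerivAt z (g' - ε • (s' • q t + σ t • q')) t := by
        have h1 := hgt.2.sub ((hσt.2.const_mul ε).smul hqt.2)
        refine h1.congr_deriv ?_
        module
      have hZ : ‖g' - ε • (s' • q t + σ t • q')‖ ^ 2 ≤ r ^ 2 + ε * X + B * ε ^ 2 :=
        norm_sub_smul_add_sq_le hε0.le (hq1 t) hst hmono hs'S (hσ0 t htI) (hσS t htI) hq'K
      have hνsq : ‖z t‖ ^ 2 = variedNormSq ε r (σ t) :=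
        norm_sub_smul_sq_eq_variedNormSq ε (σ t) (hg1 t) (hq1 t) (hcos t htI)
      obtain ⟨y, hy⟩ := exists_isClosest hn (hball (hcball t htI))
      -- The closest points of `c t` and of `γ t` differ by `O(ε)`.
      have hcosR : ‖z t‖ * Real.cos (rho N (c t)) ≤ Real.cos r - ε * σ t + C * ε ^ 2 := by
        have h1 : ‖q t - y‖ ≤ L * (4 * S) * ε := by
          have h := hL _ (hcball t htI) _ (hγδ t htI) _ _ hy (hp t htI)
          rw [Subtype.dist_eq, dist_eq_norm, norm_sub_rev] at h
          refine (h.trans (mul_le_mul_of_nonneg_left (hcγ t htI) L.coe_nonneg)).trans_eq ?_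
          ring
        have h4 : inner ℝ (g t) (y : EuclideanSpace ℝ (Fin (n + 1))) ≤ Real.cos r := by
          rw [hrt, hcos t htI]; exact (hp t htI).2 y hy.1
        rw [hy.cos_rho_eq hn, ← real_inner_smul_left, hc, norm_smul_sphProj (hz0 t htI)]
        exact inner_sub_smul_le hε1.le (hq1 t) (norm_coe y) h4 h1 (hσ0 t htI) (hσS t htI)
      have hmem : (r, σ t, X) ∈ Icc r₀ r₁ ×ˢ Icc 0 S ×ˢ Icc (-M) M :=
        ⟨hr t htI, ⟨hσ0 t htI, hσS t htI⟩, abs_le.1 hXM⟩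
      obtain ⟨hA, hEt⟩ := hE _ hmem
      have hRpos : 0 < rho N (c t) := by
        rw [hy.rho_eq hn]
        exact Real.arccos_pos.2 (inner_lt_one_of_isClosest (hball (hcball t htI)) hy)
      have hRpi : rho N (c t) ≤ Real.pi := by
        rw [hy.rho_eq hn]; exact Real.arccos_le_pi _
      have hzpos : 0 < ‖z t‖ := norm_pos_iff.2 (hz0 t htI)
      have hfin := inv_mul_div_le_variedEnergy hzpos hνsq hZ hRpos.le hRpi hcosR hA
      have hsp : speed c t ≤ ENNReal.ofReal (‖g' - ε • (s' • q t + σ t • q')‖ / ‖z t‖) := by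
        rw [speed, ← ofReal_norm]
        exact ENNReal.ofReal_le_ofReal (norm_deriv_sphProj_le hzd (hz0 t htI))
      have hle : (1 + variedEnergy C B ε r (σ t) X) / 2 ≤ 1 + ε / 2 * (G t + κ) := by
        rw [hcosd] at hFt
        rw [abs_of_pos hε0] at hEt
        simp only at hEt
        have h1 := mul_le_mul_of_nonneg_left hFt hε0.le
        have h2 := hEt.trans (add_le_add_left (add_le_add_right h1 1) (κ * ε))
        linarith
      have hnn : 0 ≤ (rho N (c t))⁻¹ * (‖g' - ε • (s' • q t + σ t • q')‖ / ‖z t‖) := by positivity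
      refine ⟨hnn.trans (hfin.trans hle), ?_⟩
      rw [hy.distTo_eq hn, ← hy.rho_eq hn, ← ENNReal.ofReal_inv_of_pos hRpos]
      refine (mul_le_mul_right hsp _).trans ?_
      rw [← ENNReal.ofReal_mul (inv_nonneg.2 hRpos.le)]
      exact ENNReal.ofReal_le_ofReal (hfin.trans hle)
    have hint : IntegrableOn (fun t => 1 + ε / 2 * (G t + κ)) (Icc a b) := by
      rw [← intervalIntegrable_iff_integrableOn_Icc_of_le hab.le]
      exact intervalIntegrable_const.add ((hG.add intervalIntegrable_const).const_mul _)
    have h1 : ENNReal.ofReal (b - a)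
        ≤ ENNReal.ofReal (∫ t in Icc a b, (1 + ε / 2 * (G t + κ))) := by
      rw [ofReal_integral_eq_lintegral_ofReal hint (hbound.mono fun t ht => ht.1)]
      exact hmin.trans (lintegral_mono_ae (hbound.mono fun t ht => ht.2))
    rw [ENNReal.ofReal_le_ofReal_iff (integral_nonneg_of_ae (hbound.mono fun t ht => ht.1)),
      integral_Icc_eq_integral_Ioc, ← intervalIntegral.integral_of_le hab.le,
      intervalIntegral.integral_add intervalIntegrable_const
        ((hG.add intervalIntegrable_const).const_mul _),
      intervalIntegral.integral_const_mul, intervalIntegral.integral_add hG intervalIntegrable_const,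
      intervalIntegral.integral_const, intervalIntegral.integral_const] at h1
    simp only [smul_eq_mul, mul_one] at h1
    have h2 : 0 ≤ ε / 2 * ((∫ t in a..b, G t) + (b - a) * κ) := by linarith
    rw [mul_comm κ]
    exact nonneg_of_mul_nonneg_right h2 (half_pos hε0)
  refine le_of_forall_pos_le_add fun κ hκ => ?_
  have h := key (κ / (b - a)) (div_pos hκ (sub_pos.2 hab))
  rwa [div_mul_cancel₀ _ (sub_pos.2 hab).ne'] at h

/-! ### The midpoint inequality -/

theorem mul_cos_le_sin {r : ℝ} (h0 : 0 < r) (h1 : r < Real.pi) : r * Real.cos r ≤ Real.sin r := by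
  rcases lt_or_ge r (Real.pi / 2) with h | h
  · have hcos : 0 < Real.cos r := Real.cos_pos_of_mem_Ioo ⟨by linarith, h⟩
    have h2 := Real.lt_tan h0 h
    rw [Real.tan_eq_sin_div_cos, lt_div_iff₀ hcos] at h2
    exact h2.le
  · have hcos := Real.cos_nonpos_of_pi_div_two_le_of_le h (by linarith)
    have hsin := Real.sin_pos_of_pos_of_lt_pi h0 h1
    nlinarith

/-- The integrand of the first variation for `σ = η * (r / sin r)`. This choice moves each point
`γ t` at the rate `η * r` away from `N`; that it only leaves the term in `η'` is the inequality
`r * cot r ≤ 1`, i.e. the bound `Hess (ρ ^ 2 / 2) ≤ g`. -/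
theorem variation_integrand_le {r r' s η : ℝ} (h0 : 0 < r) (h1 : r < Real.pi) (hr' : |r'| ≤ r)
    (hη : 0 ≤ η) :
    -2 * (s * (r / Real.sin r)
        + η * ((Real.sin r - r * Real.cos r) / Real.sin r ^ 2 * r')) * (-Real.sin r * r') / r ^ 2
      + 2 * (η * (r / Real.sin r)) * Real.cos r - 2 * (η * (r / Real.sin r)) * Real.sin r / r
      ≤ 2 * s * (r' / r) := by
  have hsin := Real.sin_pos_of_pos_of_lt_pi h0 h1
  have hmul := mul_cos_le_sin h0 h1
  have hsq : r' ^ 2 ≤ r ^ 2 := sq_le_sq' (abs_le.1 hr').1 (abs_le.1 hr').2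
  have heq : 2 * s * (r' / r) - (-2 * (s * (r / Real.sin r)
        + η * ((Real.sin r - r * Real.cos r) / Real.sin r ^ 2 * r')) * (-Real.sin r * r') / r ^ 2
      + 2 * (η * (r / Real.sin r)) * Real.cos r - 2 * (η * (r / Real.sin r)) * Real.sin r / r)
      = 2 * η * (Real.sin r - r * Real.cos r) * (r ^ 2 - r' ^ 2) / (Real.sin r * r ^ 2) := by
    field_simp
    ring
  have hnn : 0 ≤ 2 * η * (Real.sin r - r * Real.cos r) * (r ^ 2 - r' ^ 2) / (Real.sin r * r ^ 2) :=
    div_nonneg (mul_nonneg (mul_nonneg (by linarith) (by linarith)) (by linarith)) (by positivity)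
  linarith

theorem exists_lipschitzOnWith_mul {u v : ℝ → ℝ} {K M : ℝ≥0} {a b : ℝ}
    (hu : LipschitzOnWith K u (Icc a b)) (hv : LipschitzOnWith M v (Icc a b)) :
    ∃ L : ℝ≥0, LipschitzOnWith L (fun t => u t * v t) (Icc a b) := by
  obtain ⟨U, hU⟩ := isCompact_Icc.exists_bound_of_continuousOn hu.continuousOn
  obtain ⟨V, hV⟩ := isCompact_Icc.exists_bound_of_continuousOn hv.continuousOn
  refine ⟨U.toNNReal * M + K * V.toNNReal, LipschitzOnWith.of_dist_le_mul fun s hs t ht => ?_⟩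
  have hU0 : 0 ≤ U := (norm_nonneg _).trans (hU t ht)
  have hV0 : 0 ≤ V := (norm_nonneg _).trans (hV t ht)
  have h1 := hu.dist_le_mul s hs t ht
  have h2 := hv.dist_le_mul s hs t ht
  rw [dist_eq_norm] at h1 h2 ⊢
  have h3 : u s * v s - u t * v t = u s * (v s - v t) + (u s - u t) * v t := by ring
  have h4 : ‖u s * (v s - v t)‖ ≤ U * (M * dist s t) := by
    rw [norm_mul]; exact mul_le_mul (hU s hs) h2 (norm_nonneg _) hU0
  have h5 : ‖(u s - u t) * v t‖ ≤ K * dist s t * V := by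
    rw [norm_mul]; exact mul_le_mul h1 (hV t ht) (norm_nonneg _) (by positivity)
  rw [h3]
  push_cast [Real.coe_toNNReal U hU0, Real.coe_toNNReal V hV0]
  linarith [norm_add_le (u s * (v s - v t)) ((u s - u t) * v t)]

theorem hasDerivAt_tent {a b t : ℝ} (ht : t ≠ (a + b) / 2) :
    HasDerivAt (fun t => min (t - a) (b - t)) (if t ≤ (a + b) / 2 then 1 else -1) t := by
  split_ifs with h
  · have h' : t < (a + b) / 2 := lt_of_le_of_ne h ht
    refine ((hasDerivAt_id t).sub_const a).congr_of_eventuallyEq ?_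
    filter_upwards [eventually_lt_nhds h'] with s hs
    exact min_eq_left (by linarith)
  · refine ((hasDerivAt_id t).const_sub b).congr_of_eventuallyEq ?_
    filter_upwards [eventually_gt_nhds (not_le.1 h)] with s hs
    exact min_eq_right (by linarith)

theorem lipschitzWith_tent (a b : ℝ) : LipschitzWith 1 fun t : ℝ => min (t - a) (b - t) := by
  have h1 : LipschitzWith 1 fun t : ℝ => t - a :=
    LipschitzWith.of_dist_le_mul fun x y => by simp [Real.dist_eq]
  have h2 : LipschitzWith 1 fun t : ℝ => b - t :=
    LipschitzWith.of_dist_le_mul fun x y => by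
      rw [Real.dist_eq, Real.dist_eq, NNReal.coe_one, one_mul, sub_sub_sub_cancel_left,
        abs_sub_comm]
  simpa using h1.min h2

/-- The integral of `-2 * η' * φ'` for the tent function `η t = min (t - a) (b - t)`. -/
theorem integral_tent_deriv_mul_deriv {φ : ℝ → ℝ} {a b : ℝ} {K : ℝ≥0} (hab : a ≤ b)
    (hφ : LipschitzOnWith K φ (Icc a b)) :
    IntervalIntegrable (fun t => -2 * (if t ≤ (a + b) / 2 then 1 else -1) * deriv φ t) volume a b ∧
      ∫ t in a..b, -2 * (if t ≤ (a + b) / 2 then 1 else -1) * deriv φ t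
        = 2 * (φ a + φ b - 2 * φ ((a + b) / 2)) := by
  set m := (a + b) / 2 with hm
  have ham : a ≤ m := by rw [hm]; linarith
  have hmb : m ≤ b := by rw [hm]; linarith
  have h1 : AbsolutelyContinuousOnInterval φ a m :=
    LipschitzOnWith.absolutelyContinuousOnInterval
      (hφ.mono (by rw [uIcc_of_le ham]; exact Icc_subset_Icc le_rfl hmb))
  have h2 : AbsolutelyContinuousOnInterval φ m b :=
    LipschitzOnWith.absolutelyContinuousOnInterval
      (hφ.mono (by rw [uIcc_of_le hmb]; exact Icc_subset_Icc ham le_rfl))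
  have e1 : EqOn (fun t => -2 * deriv φ t)
      (fun t => -2 * (if t ≤ m then 1 else -1) * deriv φ t) (uIoc a m) := by
    intro t ht
    rw [uIoc_of_le ham] at ht
    simp [ht.2]
  have e2 : EqOn (fun t => 2 * deriv φ t)
      (fun t => -2 * (if t ≤ m then 1 else -1) * deriv φ t) (uIoc m b) := by
    intro t ht
    rw [uIoc_of_le hmb] at ht
    simp [ht.1.not_ge]
  have i1 := (h1.intervalIntegrable_deriv.const_mul (-2)).congr e1
  have i2 := (h2.intervalIntegrable_deriv.const_mul 2).congr e2
  refine ⟨i1.trans i2, ?_⟩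
  rw [← intervalIntegral.integral_add_adjacent_intervals i1 i2,
    ← intervalIntegral.integral_congr_ae (Eventually.of_forall fun t ht => e1 ht),
    ← intervalIntegral.integral_congr_ae (Eventually.of_forall fun t ht => e2 ht),
    intervalIntegral.integral_const_mul, intervalIntegral.integral_const_mul,
    h1.integral_deriv_eq_sub, h2.integral_deriv_eq_sub]
  ring

/-- Midpoint convexity of `-log ρ` along a short minimizing geodesic, from the first variation with
a tent function. -/
theorem two_mul_neg_log_rho_le (hn : n ≠ 0) {N : Set (Sph n)} {γ : ℝ → Sph n}
    {a b : ℝ} (hab : a < b) (hγ : IsMinimizingGeodesic N γ a b) {x₀ : Sph n} {δ : ℝ} {L : ℝ≥0}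
    (hδ : 0 < δ) (hball : Metric.ball x₀ δ ⊆ smoothLocus N)
    (hL : ∀ w ∈ Metric.ball x₀ δ, ∀ w' ∈ Metric.ball x₀ δ, ∀ y y',
      IsClosest N w y → IsClosest N w' y' → dist y y' ≤ L * dist w w')
    (hγx : ∀ t ∈ Icc a b, γ t ∈ Metric.ball x₀ (δ / 2)) :
    2 * -Real.log (rho N (γ ((a + b) / 2)))
      ≤ -Real.log (rho N (γ a)) + -Real.log (rho N (γ b)) := by
  have hγδ : ∀ t ∈ Icc a b, γ t ∈ Metric.ball x₀ δ := fun t ht =>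
    Metric.ball_subset_ball (by linarith) (hγx t ht)
  have hU : ∀ t ∈ Icc a b, γ t ∈ smoothLocus N := fun t ht => hball (hγδ t ht)
  have hex : ∀ t, ∃ y, t ∈ Icc a b → IsClosest N (γ t) y := by
    intro t
    by_cases ht : t ∈ Icc a b
    · obtain ⟨y, hy⟩ := exists_isClosest hn (hU t ht)
      exact ⟨y, fun _ => hy⟩
    · exact ⟨γ t, fun h => absurd h ht⟩
  choose p hp using hex
  obtain ⟨K, hK⟩ := hγ.1.coe
  have hqL := lipschitzOnWith_closest hL hK hγδ hp
  have hspeed := ae_norm_deriv_eq_rho hn hγ hU hp hqL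
  set r : ℝ → ℝ := fun t => rho N (γ t) with hr
  have hhL := lipschitzOnWith_inner hK hqL (fun t _ => norm_coe _) (fun t _ => norm_coe _)
  have hhI : MapsTo (fun t => (inner ℝ (γ t : EuclideanSpace ℝ (Fin (n + 1))) (p t) : ℝ))
      (Icc a b) (Ioo (-1) 1) := fun t ht =>
    ⟨neg_one_lt_inner_of_isClosest hn (hU t ht) (hp t ht),
      inner_lt_one_of_isClosest (hU t ht) (hp t ht)⟩
  have hreq : ∀ t ∈ Icc a b, r t = Real.arccos
      (inner ℝ (γ t : EuclideanSpace ℝ (Fin (n + 1))) (p t)) := fun t ht => (hp t ht).rho_eq hn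
  obtain ⟨Kr, hrL⟩ : ∃ Kr : ℝ≥0, LipschitzOnWith Kr r (Icc a b) := by
    obtain ⟨M, hM⟩ := exists_lipschitzOnWith_comp (f := Real.arccos) hab.le (fun x hx =>
      (Real.contDiffAt_arccos hx.1.ne' hx.2.ne).contDiffWithinAt) hhL hhI
    refine ⟨M, fun s hs t ht => ?_⟩
    rw [hreq s hs, hreq t ht]
    exact hM hs ht
  have hrI : MapsTo r (Icc a b) (Ioo 0 Real.pi) := by
    intro t ht
    rw [hreq t ht]
    refine ⟨Real.arccos_pos.2 (hhI ht).2, ?_⟩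
    rw [← Real.arccos_neg_one]
    exact Real.strictAntiOn_arccos ⟨le_rfl, by norm_num⟩ ⟨(hhI ht).1.le, (hhI ht).2.le⟩ (hhI ht).1
  have hne : (Icc a b).Nonempty := nonempty_Icc.2 hab.le
  obtain ⟨t₀, ht₀, hmin⟩ := isCompact_Icc.exists_isMinOn hne hrL.continuousOn
  obtain ⟨t₁, ht₁, hmax⟩ := isCompact_Icc.exists_isMaxOn hne hrL.continuousOn
  obtain ⟨Kφ, hφL⟩ := exists_lipschitzOnWith_comp (f := fun x => -Real.log x) hab.le (fun x hx =>
    (Real.contDiffAt_log.2 hx.1.ne').neg.contDiffWithinAt) hrL hrI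
  obtain ⟨Kw, hwL⟩ := exists_lipschitzOnWith_comp (f := fun x => x / Real.sin x) hab.le (fun x hx =>
    (contDiffAt_id.div Real.contDiff_sin.contDiffAt
      (Real.sin_pos_of_pos_of_lt_pi hx.1 hx.2).ne').contDiffWithinAt) hrL hrI
  obtain ⟨Kσ, hσL⟩ := exists_lipschitzOnWith_mul (lipschitzWith_tent a b).lipschitzOnWith hwL
  obtain ⟨hint, hval⟩ := integral_tent_deriv_mul_deriv hab.le hφL
  have hη0 : ∀ t ∈ Icc a b, 0 ≤ min (t - a) (b - t) := fun t ht =>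
    le_min (by linarith [ht.1]) (by linarith [ht.2])
  have hmain := integral_nonneg_of_isMinimizingGeodesic hn hab hγ hδ hball hL hγx hp
    (hrI ht₀).1 (hrI ht₁).2 (fun t ht => ⟨hmin ht, hmax ht⟩) hσL
    (fun t ht => mul_nonneg (hη0 t ht) (div_nonneg (hrI ht).1.le
      (Real.sin_pos_of_pos_of_lt_pi (hrI ht).1 (hrI ht).2).le))
    (by simp [hab.le]) (by simp [hab.le]) hint ?_
  · rw [hval] at hmain
    linarith
  have hmid : ∀ᵐ t ∂(volume.restrict (Icc a b)), t ≠ (a + b) / 2 :=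
    ae_restrict_of_ae (Measure.ae_ne volume _)
  filter_upwards [hspeed, hmid, ae_hasDerivAt_of_lipschitzOnWith hK,
    ae_hasDerivAt_of_lipschitzOnWith hqL, ae_hasDerivAt_of_lipschitzOnWith hrL]
    with t hst htm hgt hqt hrt
  have htI : t ∈ Icc a b := Ioo_subset_Icc_self hgt.1
  have hnhds : Icc a b ∈ 𝓝 t := Icc_mem_nhds hgt.1.1 hgt.1.2
  have hr0 := (hrI htI).1
  have hr1 := (hrI htI).2
  have hsin := Real.sin_pos_of_pos_of_lt_pi hr0 hr1
  set r' := deriv r t with hr'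
  have hcos1 := hasDerivAt_cos_rho hn hgt.2 hqt.2
    (by filter_upwards [hnhds] with s hs using hp s hs)
  have hcos2 : HasDerivAt (fun s => Real.cos (rho N (γ s))) (-Real.sin (r t) * r') t := hrt.2.cos
  -- `|∇ρ| ≤ 1`, and `γ` has speed `ρ`.
  have hr'r : |r'| ≤ r t := by
    have h1 := abs_inner_le_of_inner_eq_zero (norm_coe (γ t)) (norm_coe (p t))
      (inner_deriv_eq_zero_of_norm_eq_one (Eventually.of_forall fun s => norm_coe _) hgt.2)
    rw [hcos1.unique hcos2, hst, ← (hp t htI).cos_rho_eq hn, ← Real.sin_sq,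
      Real.sqrt_sq hsin.le, abs_mul, abs_neg, abs_of_pos hsin, mul_comm] at h1
    exact le_of_mul_le_mul_right h1 hsin
  have hw : HasDerivAt (fun s => r s / Real.sin (r s))
      ((Real.sin (r t) - r t * Real.cos (r t)) / Real.sin (r t) ^ 2 * r') t := by
    refine (hrt.2.div hrt.2.sin hsin.ne').congr_deriv ?_
    ring
  have hσ := (hasDerivAt_tent htm).mul hw
  have hφ := (hrt.2.log hr0.ne').neg
  have hσd : deriv (fun t => min (t - a) (b - t) * (r t / Real.sin (r t))) t = _ := hσ.deriv
  have hφd : deriv (fun t => -Real.log (r t)) t = _ := hφ.deriv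
  rw [hσd, hcos2.deriv, hφd]
  refine (variation_integrand_le hr0 hr1 hr'r (hη0 t htI)).trans_eq ?_
  ring

/-! ### Convexity -/

theorem convexOn_of_eventually_midpoint {φ : ℝ → ℝ} {I : Set ℝ} (hI : I.OrdConnected)
    (hφ : ContinuousOn φ I)
    (h : ∀ x ∈ I, ∀ y ∈ I, ∀ t ∈ Ioo x y, ∀ᶠ δ in 𝓝[>] (0 : ℝ), 2 * φ t ≤ φ (t - δ) + φ (t + δ)) :
    ConvexOn ℝ I φ := by
  refine LinearOrder.convexOn_of_lt hI.convex fun x hx y hy hxy α β hα hβ hαβ => ?_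
  have hsub : Icc x y ⊆ I := hI.out hx hy
  set l : ℝ → ℝ := fun t => φ x + (t - x) * ((φ y - φ x) / (y - x)) with hl
  have hyx : 0 < y - x := sub_pos.2 hxy
  set ψ : ℝ → ℝ := fun t => φ t - l t with hψ
  have hψc : ContinuousOn ψ (Icc x y) := (hφ.mono hsub).sub (by simp only [hl]; fun_prop)
  have hψx : ψ x = 0 := by simp [hψ, hl]
  have hψy : ψ y = 0 := by simp only [hψ, hl]; field_simp; ring
  have key : ∀ t ∈ Icc x y, ψ t ≤ 0 := by
    by_contra! hcon
    obtain ⟨u, hu, hu0⟩ := hcon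
    obtain ⟨m, hm, hmax⟩ := isCompact_Icc.exists_isMaxOn ⟨u, hu⟩ hψc
    have hm0 : 0 < ψ m := hu0.trans_le (hmax hu)
    -- The leftmost maximum point violates the midpoint inequality.
    have hcomp : IsCompact (Icc x y ∩ ψ ⁻¹' {ψ m}) :=
      isCompact_Icc.of_isClosed_subset
        (hψc.preimage_isClosed_of_isClosed isClosed_Icc isClosed_singleton) inter_subset_left
    obtain ⟨t, ⟨ht, htm⟩, hleast⟩ := hcomp.exists_isLeast ⟨m, hm, rfl⟩
    have htm' : ψ t = ψ m := htm
    have htx : x < t := lt_of_le_of_ne ht.1 fun h => by rw [← h, hψx] at htm'; linarith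
    have hty : t < y := lt_of_le_of_ne ht.2 fun h => by rw [h, hψy] at htm'; linarith
    have hsmall : ∀ᶠ δ in 𝓝[>] (0 : ℝ), δ ∈ Ioo 0 (min (t - x) (y - t)) :=
      Ioo_mem_nhdsGT (lt_min (by linarith) (by linarith))
    obtain ⟨δ, hδ, hδ0, hδ1⟩ := ((h x hx y hy t ⟨htx, hty⟩).and hsmall).exists
    have hδx := hδ1.trans_le (min_le_left _ _)
    have hδy := hδ1.trans_le (min_le_right _ _)
    have h1 : t - δ ∈ Icc x y := ⟨by linarith, by linarith⟩
    have h2 : t + δ ∈ Icc x y := ⟨by linarith, by linarith⟩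
    have h3 : ψ (t - δ) < ψ m := lt_of_le_of_ne (hmax h1) fun he => by
      have := hleast ⟨h1, he⟩
      linarith
    have h4 : ψ (t + δ) ≤ ψ m := hmax h2
    have h5 : 2 * ψ t ≤ ψ (t - δ) + ψ (t + δ) := by
      simp only [hψ, hl]
      linarith
    linarith
  have hmem : α * x + β * y ∈ Icc x y := by
    have hα' : α = 1 - β := by linarith
    subst hα'
    constructor <;> nlinarith
  have h1 := key _ hmem
  simp only [hψ, hl, sub_nonpos] at h1
  simp only [smul_eq_mul]
  refine h1.trans_eq ?_
  have hα' : α = 1 - β := by linarith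
  subst hα'
  field_simp
  ring

/-- The zero-dimensional sphere carries no moving Lipschitz curve. -/
theorem IsGeodesic.not_lt_of_dim_zero {N : Set (Sph 0)} {γ : ℝ → Sph 0} {I : Set ℝ}
    (hI : I.OrdConnected) (hγ : IsGeodesic N γ I) {x y : ℝ} (hx : x ∈ I) (hy : y ∈ I) :
    ¬ x < y := by
  intro hxy
  obtain ⟨ε, hε, hmin⟩ := hγ x hx
  set b := min y (x + ε / 2) with hb
  have hxb : x < b := lt_min hxy (by linarith)
  have hbI : b ∈ I := hI.out hx hy ⟨hxb.le, min_le_left _ _⟩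
  have hbx : b ≤ x + ε / 2 := min_le_right _ _
  have hg := hmin x hx b hbI hxb.le (by simpa using hε)
    (by rw [abs_of_nonneg (by linarith)]; linarith)
  obtain ⟨K, hK⟩ := hg.1.coe
  have hlen := hg.2.1 x ⟨le_rfl, hxb.le⟩ b ⟨hxb.le, le_rfl⟩ hxb.le
  have hzero : condLength N γ x b = 0 := by
    rw [condLength, arcLength, ← lintegral_zero (μ := volume.restrict (Icc x b))]
    refine lintegral_congr_ae ?_
    filter_upwards [ae_hasDerivAt_of_lipschitzOnWith hK] with t ht
    have horth := inner_deriv_eq_zero_of_norm_eq_one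
      (Eventually.of_forall fun s => norm_coe (γ s)) ht.2
    have hd : deriv (fun s => (γ s : EuclideanSpace ℝ (Fin (0 + 1)))) t = 0 := by
      have h1 := norm_coe (γ t)
      rw [EuclideanSpace.norm_eq] at h1
      rw [PiLp.inner_apply] at horth
      simp only [Fin.sum_univ_succ, Fin.sum_univ_zero, add_zero] at h1 horth
      have h0 : (γ t : EuclideanSpace ℝ (Fin (0 + 1))) 0 ≠ 0 := by
        rw [← norm_ne_zero_iff]
        rintro h
        simp [h] at h1
      ext i
      fin_cases i
      simpa [h0] using horth
    rw [speed, hd, enorm_zero, mul_zero]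
  rw [hzero, eq_comm, ENNReal.ofReal_eq_zero] at hlen
  linarith

theorem IsGeodesic.continuousOn {N : Set (Sph n)} {γ : ℝ → Sph n} {I : Set ℝ}
    (hI : I.OrdConnected) (hγ : IsGeodesic N γ I) : ContinuousOn γ I := by
  intro t ht
  obtain ⟨ε, hε, hmin⟩ := hγ t ht
  -- At an endpoint of `I` the curve is only known on one side of `t`.
  have hleft : ∃ a ∈ I, a ≤ t ∧ |a - t| < ε ∧ Ici a ∈ 𝓝[I] t := by
    by_cases h : ∃ u ∈ I, u < t
    · obtain ⟨u, hu, hut⟩ := h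
      have hlt : max u (t - ε / 2) < t := max_lt hut (by linarith)
      refine ⟨max u (t - ε / 2), hI.out hu ht ⟨le_max_left _ _, hlt.le⟩, hlt.le, ?_,
        nhdsWithin_le_nhds (Ici_mem_nhds hlt)⟩
      rw [abs_of_neg (by linarith)]
      linarith [le_max_right u (t - ε / 2)]
    · push Not at h
      exact ⟨t, ht, le_rfl, by simpa using hε, mem_of_superset self_mem_nhdsWithin h⟩
  have hright : ∃ b ∈ I, t ≤ b ∧ |b - t| < ε ∧ Iic b ∈ 𝓝[I] t := by
    by_cases h : ∃ u ∈ I, t < u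
    · obtain ⟨u, hu, hut⟩ := h
      have hlt : t < min u (t + ε / 2) := lt_min hut (by linarith)
      refine ⟨min u (t + ε / 2), hI.out ht hu ⟨hlt.le, min_le_left _ _⟩, hlt.le, ?_,
        nhdsWithin_le_nhds (Iic_mem_nhds hlt)⟩
      rw [abs_of_pos (by linarith)]
      linarith [min_le_right u (t + ε / 2)]
    · push Not at h
      exact ⟨t, ht, le_rfl, by simpa using hε, mem_of_superset self_mem_nhdsWithin h⟩
  obtain ⟨a, ha, hat, haε, haN⟩ := hleft
  obtain ⟨b, hb, htb, hbε, hbN⟩ := hright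
  obtain ⟨K, hK⟩ := (hmin a ha b hb (hat.trans htb) haε hbε).1.1
  exact (hK.continuousOn t ⟨hat, htb⟩).mono_of_mem_nhdsWithin (inter_mem haN hbN)

theorem rho_pos_of_mem_smoothLocus (hn : n ≠ 0) {N : Set (Sph n)} {x : Sph n}
    (hx : x ∈ smoothLocus N) : 0 < rho N x := by
  obtain ⟨y, hy⟩ := exists_isClosest hn hx
  rw [hy.rho_eq hn]
  exact Real.arccos_pos.2 (inner_lt_one_of_isClosest hx hy)

end ConditionMetric

theorem theorem2 (n : ℕ) (N : Set (ConditionMetric.Sph n))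
    (hN : ConditionMetric.IsC2Submanifold N)
    (hN' : ConditionMetric.IsCompleteSubmanifold N)
    (I : Set ℝ) (hI : I.OrdConnected) (γ : ℝ → ConditionMetric.Sph n)
    (hγ : ConditionMetric.IsGeodesic N γ I)
    (hU : Set.MapsTo γ I (ConditionMetric.smoothLocus N)) :
    ConvexOn ℝ I (fun t => Real.log (1 / ConditionMetric.rho N (γ t))) := by
  open ConditionMetric Filter Topology in
  rcases eq_or_ne n 0 with rfl | hn
  · exact LinearOrder.convexOn_of_lt hI.convex fun x hx y hy hxy =>
      absurd hxy (hγ.not_lt_of_dim_zero hI hx hy)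
  simp only [one_div, Real.log_inv]
  have hcont := hγ.continuousOn hI
  refine convexOn_of_eventually_midpoint hI ?_ fun x hx y hy t ht => ?_
  · intro t ht
    have h1 : ContinuousAt (rho N) (γ t) := (contMDiffAt_rho (hU ht)).continuousAt
    exact ((h1.comp_continuousWithinAt (hcont t ht)).log
      (rho_pos_of_mem_smoothLocus hn (hU ht)).ne').neg
  have htI : t ∈ I := hI.out hx hy ⟨ht.1.le, ht.2.le⟩
  obtain ⟨ε, hε, hmin⟩ := hγ t htI
  obtain ⟨δ₀, hδ₀, L, hball, hL⟩ := exists_lipschitz_isClosest hn (hU htI)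
  have hnhds : I ∈ 𝓝 t :=
    mem_of_superset (Icc_mem_nhds ht.1 ht.2) (hI.out hx hy)
  have hγball : ∀ᶠ s in 𝓝 t, s ∈ I ∧ γ s ∈ Metric.ball (γ t) (δ₀ / 2) :=
    (show ∀ᶠ s in 𝓝 t, s ∈ I from hnhds).and (((hcont t htI).continuousAt hnhds).eventually
      (Metric.ball_mem_nhds _ (half_pos hδ₀)))
  obtain ⟨η, hη, hηball⟩ := Metric.eventually_nhds_iff.1 hγball
  filter_upwards [Ioo_mem_nhdsGT (lt_min hη hε)] with δ hδ
  have hδη := hδ.2.trans_le (min_le_left _ _)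
  have hδε := hδ.2.trans_le (min_le_right _ _)
  have hmem : ∀ s ∈ Icc (t - δ) (t + δ), s ∈ I ∧ γ s ∈ Metric.ball (γ t) (δ₀ / 2) := by
    intro s hs
    refine hηball ?_
    rw [Real.dist_eq]
    exact (abs_le.2 ⟨by linarith [hs.1], by linarith [hs.2]⟩).trans_lt hδη
  have hle : t - δ < t + δ := by linarith [hδ.1]
  have hgeo := hmin (t - δ) (hmem _ ⟨le_rfl, hle.le⟩).1 (t + δ) (hmem _ ⟨hle.le, le_rfl⟩).1 hle.le
    (by rw [sub_sub_cancel_left, abs_neg, abs_of_pos hδ.1]; exact hδε)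
    (by rw [add_sub_cancel_left, abs_of_pos hδ.1]; exact hδε)
  have h := two_mul_neg_log_rho_le hn hle hgeo hδ₀ hball hL fun s hs => (hmem s hs).2
  rwa [show (t - δ + (t + δ)) / 2 = t by ring] at h
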